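/- Let $\varepsilon\in\mathbb R$ and $\rho=1/\sqrt{1+\varepsilon^2}$. On the open unit disk $\mathbb D^2\subset\mathbb R^2$ let $h_p(y,w)=\frac{\langle y,w\rangle}{1-|p|^2}+\frac{\langle p,y\rangle\langle p,w\rangle}{(1-|p|^2)^2}$ be the Klein metric, let $u_p=(1-|p|^2)\,p$, let $\Phi_p(y)=\sqrt{h_p(y,y)}+h_p(u_p,y)$ be the Funk metric, and let $v_p=(-p_2,p_1)$ be the rotation field. Then for every $p$ in the open disk $\mathbb D^2(\rho)$ of radius $\rho$ about the origin and every $y\neq0$ there is exactly one $F=F(p,y)>0$ with $$\Phi_p\Big(\frac{y}{F}-\varepsilon v_p\Big)=1 .$$ With $F(p,0)=0$, the function $F$ is a Randers metric on $\mathbb D^2(\rho)$: it is a Finsler metric $F=\alpha+\beta$ with $\alpha$ a smooth Riemannian metric and $\beta$ a smooth $1$-form of $\alpha$-norm less than $1$ at every point. Moreover: (a) $F$ has constant flag curvature $\mathbf K=-\frac14$, i.e. $R^i{}_k=-\frac14\{F^2\delta^i_k-FF_{y^k}y^i\}$, where $R^i{}_k$ is the Riemann curvature of $F$; (b) $\mathbf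 S=\frac32F$, where $\mathbf S=\frac{\partial G^i}{\partial y^i}-\frac{y^i}{\sigma}\frac{\partial\sigma}{\partial x^i}$ is the S-curvature with respect to the Busemann--Hausdorff volume form $\sigma\,dx^1dx^2$ and $G^i$ are the geodesic coefficients (geodesics satisfy $\ddot x^i+2G^i(x,\dot x)=0$); (c) $F$ is locally projectively flat (every point has a neighbourhood with a coordinate system in which the geodesics of $F$ are straight lines) if and only if $\varepsilon=0$; (d) the Gauss curvature of $\alpha$ is not constant if $\varepsilon\ne0$, and it is identically $-1$ if $\varepsilon=0$. -/

import Mathlib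

open Set
open scoped ContDiff

noncomputable section

/-! ## Finsler geometry on an open subset of `ℝⁿ`, in the standard coordinates

A metric is a function `F x y` of a point `x` and a tangent vector `y`. -/

namespace Finsler

/-- The coordinate space `ℝⁿ`, with the Euclidean norm. -/
abbrev E (n : ℕ) : Type := EuclideanSpace ℝ (Fin n)

variable {n : ℕ}

/-- The partial derivative `∂f/∂xⁱ` at `x`. -/
def pd (i : Fin n) (f : E n → ℝ) (x : E n) : ℝ :=
  lineDeriv ℝ f x (EuclideanSpace.single i 1)

/-- The fundamental tensor `g_ij = ½ [F²]_{yⁱ yʲ}`. -/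
def fundTensor (F : E n → E n → ℝ) (x y : E n) : Matrix (Fin n) (Fin n) ℝ :=
  Matrix.of fun i j => (1 / 2 : ℝ) * pd j (fun w => pd i (fun z => F x z ^ 2) w) y

/-- `F` is a Finsler metric on `U`: nonnegative, positive off the zero section, positively
homogeneous of degree one, smooth off the zero section, and strongly convex. -/
structure IsFinslerMetric (F : E n → E n → ℝ) (U : Set (E n)) : Prop where
  zero : ∀ x ∈ U, F x 0 = 0
  pos : ∀ x ∈ U, ∀ y, y ≠ 0 → 0 < F x y
  homog : ∀ x ∈ U, ∀ y, ∀ t : ℝ, 0 < t → F x (t • y) = t * F x y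
  smooth : ContDiffOn ℝ ∞ (fun q : E n × E n => F q.1 q.2) (U ×ˢ {0}ᶜ)
  convex : ∀ x ∈ U, ∀ y, y ≠ 0 → (fundTensor F x y).PosDef

/-- The geodesic coefficients
`Gⁱ = ¼ gⁱᵏ { 2 ∂g_{pk}/∂x^q - ∂g_{pq}/∂xᵏ } yᵖ y^q`. -/
def geodCoeff (F : E n → E n → ℝ) (i : Fin n) (x y : E n) : ℝ :=
  (1 / 4 : ℝ) * ∑ k, (fundTensor F x y)⁻¹ i k *
    ∑ p, ∑ q, (2 * pd q (fun z => fundTensor F z y p k) x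
      - pd k (fun z => fundTensor F z y p q) x) * y p * y q

/-- The Riemann curvature
`Rⁱ_k = 2 ∂Gⁱ/∂xᵏ - yʲ ∂²Gⁱ/∂xʲ∂yᵏ + 2 Gʲ ∂²Gⁱ/∂yʲ∂yᵏ - (∂Gⁱ/∂yʲ)(∂Gʲ/∂yᵏ)`. -/
def riemann (F : E n → E n → ℝ) (i k : Fin n) (x y : E n) : ℝ :=
  2 * pd k (fun z => geodCoeff F i z y) x
    - ∑ j, y j * pd j (fun z => pd k (fun w => geodCoeff F i z w) y) x
    + 2 * ∑ j, geodCoeff F j x y * pd j (fun w => pd k (fun w' => geodCoeff F i x w') w) y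
    - ∑ j, pd j (fun w => geodCoeff F i x w) y * pd k (fun w => geodCoeff F j x w) y

/-- `F` has constant flag curvature `c` on `U`:
`Rⁱ_k = c (F² δⁱ_k - F F_{yᵏ} yⁱ)`. -/
def HasConstFlagCurvature (F : E n → E n → ℝ) (U : Set (E n)) (c : ℝ) : Prop :=
  ∀ x ∈ U, ∀ y, y ≠ 0 → ∀ i k, riemann F i k x y =
    c * (F x y ^ 2 * (if i = k then 1 else 0) - F x y * pd k (fun w => F x w) y * y i)

/-- The density `σ` of the Busemann-Hausdorff volume form `σ(x) dx¹ ⋯ dxⁿ`: the Lebesgue volume of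
the Euclidean unit ball over that of the unit ball `{y | F(x, y) < 1}`. -/
def bhDensity (F : E n → E n → ℝ) (x : E n) : ℝ :=
  (MeasureTheory.volume (Metric.ball (0 : E n) 1)).toReal /
    (MeasureTheory.volume {y : E n | F x y < 1}).toReal

/-- The S-curvature `S = ∂Gⁱ/∂yⁱ - (yⁱ/σ) ∂σ/∂xⁱ`. -/
def sCurvature (F : E n → E n → ℝ) (x y : E n) : ℝ :=
  ∑ i, pd i (fun w => geodCoeff F i x w) y - ∑ i, y i / bhDensity F x * pd i (bhDensity F) x

/-- `c` is a geodesic of `F` on the (open) set `I` of parameters: a regular solution of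
`c'' + 2 G(c, c') = 0`. -/
def IsGeodesicOn (F : E n → E n → ℝ) (c : ℝ → E n) (I : Set ℝ) : Prop :=
  ∀ t ∈ I, DifferentiableAt ℝ c t ∧ deriv c t ≠ 0 ∧
    HasDerivAt (deriv c)
      (WithLp.toLp 2 fun i => -2 * geodCoeff F i (c t) (deriv c t)) t

/-- `F` is locally projectively flat on `U`: around every point of `U` there is a local coordinate
system `φ` (a smooth diffeomorphism between open sets) in which all geodesics are straight, i.e. run
inside straight lines. -/
def IsLocallyProjectivelyFlat (F : E n → E n → ℝ) (U : Set (E n)) : Prop :=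
  ∀ p ∈ U, ∃ φ : OpenPartialHomeomorph (E n) (E n), p ∈ φ.source ∧ φ.source ⊆ U ∧
    ContDiffOn ℝ ∞ φ φ.source ∧ ContDiffOn ℝ ∞ φ.symm φ.target ∧
    ∀ (c : ℝ → E n) (s t : ℝ), (∀ r ∈ Ioo s t, c r ∈ φ.source) → IsGeodesicOn F c (Ioo s t) →
      Collinear ℝ ((fun r => φ (c r)) '' Ioo s t)

/-! ### Randers metrics -/

/-- The norm `α(x, y) = √(a_ij(x) yⁱ yʲ)` of a Riemannian metric `a`. -/
def alpha (a : E n → Matrix (Fin n) (Fin n) ℝ) (x y : E n) : ℝ :=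
  Real.sqrt (∑ i, ∑ j, a x i j * y i * y j)

/-- The 1-form `β(x, y) = b_i(x) yⁱ`. -/
def beta (b : E n → Fin n → ℝ) (x y : E n) : ℝ := ∑ i, b x i * y i

/-- `F = α + β` is a Randers metric on `U`: a Finsler metric which is the sum of a smooth Riemannian
metric `α` and a smooth 1-form `β` with `sup_y β(y)/α(y) < 1` at each point. -/
structure IsRandersMetric (F : E n → E n → ℝ) (a : E n → Matrix (Fin n) (Fin n) ℝ)
    (b : E n → Fin n → ℝ) (U : Set (E n)) : Prop where
  finsler : IsFinslerMetric F U
  smooth_a : ∀ i j, ContDiffOn ℝ ∞ (fun x => a x i j) U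
  posDef_a : ∀ x ∈ U, (a x).PosDef
  smooth_b : ∀ i, ContDiffOn ℝ ∞ (fun x => b x i) U
  norm_lt : ∀ x ∈ U, ∃ k : ℝ, k < 1 ∧ ∀ y, beta b x y ≤ k * alpha a x y
  eq_add : ∀ x ∈ U, ∀ y, F x y = alpha a x y + beta b x y

/-! ### Gauss curvature of a Riemannian metric on a plane domain -/

/-- The Christoffel symbols `Γˡ_ij` of the Levi-Civita connection of `a`. -/
def christoffel (a : E n → Matrix (Fin n) (Fin n) ℝ) (l i j : Fin n) (x : E n) : ℝ :=
  (1 / 2 : ℝ) * ∑ m, (a x)⁻¹ l m *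
    (pd i (fun z => a z j m) x + pd j (fun z => a z i m) x - pd m (fun z => a z i j) x)

/-- The `l`-th component of `R(∂_i, ∂_j) ∂_k = ∇_i ∇_j ∂_k - ∇_j ∇_i ∂_k`. -/
def curvTensor (a : E n → Matrix (Fin n) (Fin n) ℝ) (l i j k : Fin n) (x : E n) : ℝ :=
  pd i (christoffel a l j k) x - pd j (christoffel a l i k) x
    + ∑ m, (christoffel a l i m x * christoffel a m j k x
      - christoffel a l j m x * christoffel a m i k x)

/-- The Gauss curvature `⟨R(∂₁, ∂₂) ∂₂, ∂₁⟩ / det a` of a Riemannian metric in dimension two. -/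
def gaussCurvature (a : E 2 → Matrix (Fin 2) (Fin 2) ℝ) (x : E 2) : ℝ :=
  (∑ l, a x 0 l * curvTensor a l 0 1 1 x) / (a x).det

/-! ### The Funk metric on the unit disk and its perturbation -/

/-- The Klein metric `h` on the unit disk. -/
def klein (p y w : E 2) : ℝ :=
  inner ℝ y w / (1 - ‖p‖ ^ 2) + inner ℝ p y * inner ℝ p w / (1 - ‖p‖ ^ 2) ^ 2

/-- The Funk metric `Φ(y) = √h(y, y) + h(u, y)`, with `u = (1 - |p|²) p`. -/
def funk (p y : E 2) : ℝ :=
  Real.sqrt (klein p y y) + klein p ((1 - ‖p‖ ^ 2) • p) y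

/-- The rotation field `v_p = (-y, x)` at `p = (x, y)`. -/
def rotation (p : E 2) : E 2 := !₂[-p 1, p 0]

/-- The open disk of radius `1/√(1+ε²)` centred at the origin. -/
def disk (ε : ℝ) : Set (E 2) := Metric.ball 0 (1 / Real.sqrt (1 + ε ^ 2))

/-- `F` is obtained on `disk ε` from the Funk metric and the field `ε v`: it vanishes on zero vectors
and, for `y ≠ 0`, it is a positive solution of `Φ (y / F(y) - ε v) = 1`. -/
def IsFunkPerturbation (ε : ℝ) (F : E 2 → E 2 → ℝ) : Prop :=
  ∀ p ∈ disk ε, F p 0 = 0 ∧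
    ∀ y, y ≠ 0 → 0 < F p y ∧ funk p ((F p y)⁻¹ • y - ε • rotation p) = 1

end Finsler

end

open Finsler

/-! Write J for the rotation and q = x - εJx (`drift`). The Funk metric has the unit circle centred
at -p as indicatrix at p: Φ_p(y) = 1 means |p + y| = 1. So Φ_p(y/F - εJp) = 1 says |q + y/F| = 1,
that is, F(x, y) is the Funk metric `funkStd` at the point q applied to y. The linear map x ↦ q is a
similarity of ratio √(1+ε²), which explains the radius of the disk. Existence, uniqueness, the
Randers form and the Busemann–Hausdorff density, equal to 1, follow at once.

For the rest put η = Fq + y and R = F - ⟨q, η⟩, where R is the radical `rad`. Then |η| = F and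
F_{y^k} = η_k/R. Differentiating |Fq + y|² = F² gives Okada's relation ∂F/∂q^k = F F_{y^k}
(`hasDerivAt_funkStd`), and the fibre Hessian of F is (Jy)_k (Jy)_l / R³ (`hasDerivAt_funkDeriv`).
All derivatives needed reduce to these two, so the formula for the geodesic coefficients
(`spray_identity`) and the flag curvature equation (`flag_identity`) become polynomial identities in
q, η, F modulo |η|² = F².

For ε = 0 the spray is Fy/2 and geodesics are straight. For ε ≠ 0 the radial Funk geodesic carried
along by the rotation flow gives a spiral geodesic through the origin; its central reflection is a
geodesic as well. In a flat chart both have straight images, and comparing their second-order jets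
at the origin forces ε = 0. The Gauss curvature of α is computed explicitly and compared at two
radii. -/

noncomputable section

namespace Finsler

section

/-! ### The Funk metric of the unit disk in terms of the base point -/

/-- The square of the radical in the Funk metric. -/
def radSq (q y : E 2) : ℝ :=
  (1 - (q 0 ^ 2 + q 1 ^ 2)) * (y 0 ^ 2 + y 1 ^ 2) + (q 0 * y 0 + q 1 * y 1) ^ 2

/-- The radical in the Funk metric. -/
def rad (q y : E 2) : ℝ := Real.sqrt (radSq q y)

/-- The Funk metric of the unit disk in closed form. -/
def funkStd (q y : E 2) : ℝ :=
  (rad q y + (q 0 * y 0 + q 1 * y 1)) / (1 - (q 0 ^ 2 + q 1 ^ 2))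

/-- The derivative of the Funk metric in the `k`-th fibre coordinate. -/
def funkDeriv (q y : E 2) (k : Fin 2) : ℝ := (funkStd q y * q k + y k) / rad q y

lemma norm_sq_eq (y : E 2) : ‖y‖ ^ 2 = y 0 ^ 2 + y 1 ^ 2 := by
  simp [EuclideanSpace.norm_sq_eq]

lemma inner_eq (y w : E 2) : inner ℝ y w = y 0 * w 0 + y 1 * w 1 := by
  simp [PiLp.inner_apply, Fin.sum_univ_two, mul_comm]

lemma sq_add_sq_pos {y : E 2} (hy : y ≠ 0) : 0 < y 0 ^ 2 + y 1 ^ 2 := by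
  rw [← norm_sq_eq]; positivity

lemma gap_pos {q : E 2} (hq : ‖q‖ < 1) : 0 < 1 - (q 0 ^ 2 + q 1 ^ 2) := by
  rw [← norm_sq_eq]; nlinarith [norm_nonneg q]

lemma radSq_pos {q y : E 2} (hq : ‖q‖ < 1) (hy : y ≠ 0) : 0 < radSq q y := by
  have := mul_pos (gap_pos hq) (sq_add_sq_pos hy)
  unfold radSq; positivity

lemma rad_pos {q y : E 2} (hq : ‖q‖ < 1) (hy : y ≠ 0) : 0 < rad q y :=
  Real.sqrt_pos.2 (radSq_pos hq hy)

lemma rad_sq {q y : E 2} (hq : ‖q‖ < 1) : rad q y ^ 2 = radSq q y := by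
  refine Real.sq_sqrt ?_
  have := gap_pos hq
  unfold radSq; positivity

lemma gap_mul_funkStd {q y : E 2} (hq : ‖q‖ < 1) :
    (1 - (q 0 ^ 2 + q 1 ^ 2)) * funkStd q y = rad q y + (q 0 * y 0 + q 1 * y 1) := by
  have := (gap_pos hq).ne'
  unfold funkStd; field_simp

lemma funkStd_pos {q y : E 2} (hq : ‖q‖ < 1) (hy : y ≠ 0) : 0 < funkStd q y := by
  refine div_pos ?_ (gap_pos hq)
  have h := mul_pos (gap_pos hq) (sq_add_sq_pos hy)
  have : |q 0 * y 0 + q 1 * y 1| < rad q y := by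
    refine Real.lt_sqrt_of_sq_lt ?_
    rw [sq_abs]; unfold radSq; linarith
  linarith [neg_abs_le (q 0 * y 0 + q 1 * y 1)]

@[simp] lemma funkStd_zero (q : E 2) : funkStd q 0 = 0 := by
  simp [funkStd, rad, radSq]

lemma funkStd_smul (q y : E 2) {t : ℝ} (ht : 0 < t) : funkStd q (t • y) = t * funkStd q y := by
  have : rad q (t • y) = t * rad q y := by
    rw [rad, rad, ← Real.sqrt_sq ht.le, ← Real.sqrt_mul (sq_nonneg _), Real.sqrt_sq ht.le]
    congr 1; simp [radSq]; ring
  simp [funkStd, this]; ring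

/-- The defining quadratic equation of the Funk metric: `|F q + y|² = F²`. -/
lemma funkStd_quadratic {q y : E 2} (hq : ‖q‖ < 1) :
    (funkStd q y * q 0 + y 0) ^ 2 + (funkStd q y * q 1 + y 1) ^ 2 = funkStd q y ^ 2 := by
  have h1 := gap_mul_funkStd (y := y) hq
  have h2 := rad_sq (y := y) hq
  have h3 := (gap_pos hq).ne'
  unfold radSq at h2
  refine mul_left_cancel₀ h3 ?_
  linear_combination (2 * (q 0 * y 0 + q 1 * y 1) - (1 - (q 0 ^ 2 + q 1 ^ 2)) * funkStd q y
    - (rad q y + (q 0 * y 0 + q 1 * y 1))) * h1 - h2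

/-- `⟨F q + y, y⟩ = F R`. -/
lemma funkStd_radial {q y : E 2} (hq : ‖q‖ < 1) :
    (funkStd q y * q 0 + y 0) * y 0 + (funkStd q y * q 1 + y 1) * y 1 =
      funkStd q y * rad q y := by
  have h1 := gap_mul_funkStd (y := y) hq
  have h2 := funkStd_quadratic (y := y) hq
  linear_combination h2 + funkStd q y * h1

/-- With m = 1 - |q|² and b = ⟨q, y⟩, the identity (m - b)² - `radSq` = m(1 - |q + y|²) turns the
bound on the radical into a bound on |q + y|. The version with equality rests on the same identity.
-/
lemma funkStd_lt_one_iff {q y : E 2} (hq : ‖q‖ < 1) : funkStd q y < 1 ↔ ‖q + y‖ < 1 := by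
  have hm := gap_pos hq
  have e : ‖q + y‖ < 1 ↔ (q 0 + y 0) ^ 2 + (q 1 + y 1) ^ 2 < 1 := by
    rw [← sq_lt_one_iff₀ (norm_nonneg _), norm_sq_eq]; simp
  rw [funkStd, div_lt_one hm, e, ← lt_sub_iff_add_lt, rad]
  constructor
  · intro h
    have := (Real.sqrt_lt' ((Real.sqrt_nonneg _).trans_lt h)).1 h
    unfold radSq at this
    nlinarith
  · intro h
    -- The left-hand side is 1 - ⟨q, q + y⟩, positive because both vectors have norm less than 1.
    have hp : 0 < 1 - (q 0 ^ 2 + q 1 ^ 2) - (q 0 * y 0 + q 1 * y 1) := by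
      nlinarith [sq_nonneg (y 0), sq_nonneg (y 1)]
    rw [Real.sqrt_lt' hp, radSq]
    nlinarith

lemma funkStd_eq_one_iff {q y : E 2} (hq : ‖q‖ < 1) : funkStd q y = 1 ↔ ‖q + y‖ = 1 := by
  have hm := gap_pos hq
  have e : ‖q + y‖ = 1 ↔ (q 0 + y 0) ^ 2 + (q 1 + y 1) ^ 2 = 1 := by
    rw [← pow_eq_one_iff_of_nonneg (norm_nonneg _) two_ne_zero, norm_sq_eq]; simp
  rw [e]
  constructor
  · intro h
    have := funkStd_quadratic (y := y) hq
    rw [h] at this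
    linarith
  · intro h
    have hp : 0 ≤ 1 - (q 0 ^ 2 + q 1 ^ 2) - (q 0 * y 0 + q 1 * y 1) := by
      nlinarith [sq_nonneg (y 0), sq_nonneg (y 1), sq_nonneg (q 0 + (q 0 + y 0)),
        sq_nonneg (q 0 - (q 0 + y 0)), sq_nonneg (q 1 - (q 1 + y 1))]
    have : rad q y = 1 - (q 0 ^ 2 + q 1 ^ 2) - (q 0 * y 0 + q 1 * y 1) := by
      have h0 : 0 ≤ radSq q y := by unfold radSq; positivity
      rw [rad, Real.sqrt_eq_iff_eq_sq h0 hp, radSq]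
      linear_combination (1 - (q 0 ^ 2 + q 1 ^ 2)) * h
    rw [funkStd, this, div_eq_one_iff_eq hm.ne']
    ring

lemma funk_eq_funkStd {p y : E 2} (hp : ‖p‖ < 1) : funk p y = funkStd p y := by
  have hm := gap_pos hp
  have h : klein p y y = (rad p y / (1 - (p 0 ^ 2 + p 1 ^ 2))) ^ 2 := by
    rw [div_pow, rad_sq hp, klein, norm_sq_eq, inner_eq, inner_eq, radSq]
    field_simp
  have hs := Real.sqrt_sq (div_nonneg (Real.sqrt_nonneg _) hm.le : 0 ≤ rad p y / _)
  rw [funk, h, hs, klein, norm_sq_eq, inner_eq, inner_eq, inner_eq, funkStd]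
  simp
  field_simp
  ring

/-! ### Derivatives along curves -/

lemma hasDerivAt_coord {c : ℝ → E 2} {c' : E 2} {t : ℝ} (h : HasDerivAt c c' t) (i : Fin 2) :
    HasDerivAt (fun s => c s i) (c' i) t :=
  ((EuclideanSpace.proj (𝕜 := ℝ) i).hasFDerivAt).comp_hasDerivAt t h

variable {q y : ℝ → E 2} {q' y' : E 2} {t : ℝ}

lemma hasDerivAt_rad (hq : HasDerivAt q q' t) (hy : HasDerivAt y y' t) (hq1 : ‖q t‖ < 1)
    (hy0 : y t ≠ 0) :
    HasDerivAt (fun s => rad (q s) (y s))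
      ((-(q t 0 * q' 0 + q t 1 * q' 1) * (y t 0 ^ 2 + y t 1 ^ 2)
        + (1 - (q t 0 ^ 2 + q t 1 ^ 2)) * (y t 0 * y' 0 + y t 1 * y' 1)
        + (q t 0 * y t 0 + q t 1 * y t 1)
          * (q' 0 * y t 0 + q t 0 * y' 0 + q' 1 * y t 1 + q t 1 * y' 1)) / rad (q t) (y t)) t := by
  have a0 := hasDerivAt_coord hq 0
  have a1 := hasDerivAt_coord hq 1
  have b0 := hasDerivAt_coord hy 0
  have b1 := hasDerivAt_coord hy 1
  have h := (((((a0.pow 2).add (a1.pow 2)).const_sub 1).mul ((b0.pow 2).add (b1.pow 2))).add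
    (((a0.mul b0).add (a1.mul b1)).pow 2)).sqrt (radSq_pos hq1 hy0).ne'
  refine h.congr_deriv ?_
  have := (rad_pos hq1 hy0).ne'
  change _ / (2 * rad (q t) (y t)) = _
  field_simp
  simp
  ring

/-- Implicit differentiation of |Fq + y|² = F² gives F'(F - ⟨q, η⟩) = ⟨η, y' + Fq'⟩, and the bracket
on the left is R. Base derivatives are thus F times fibre derivatives (Okada's relation). -/
lemma hasDerivAt_funkStd (hq : HasDerivAt q q' t) (hy : HasDerivAt y y' t) (hq1 : ‖q t‖ < 1)
    (hy0 : y t ≠ 0) :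
    HasDerivAt (fun s => funkStd (q s) (y s))
      (∑ l, funkDeriv (q t) (y t) l * (y' l + funkStd (q t) (y t) * q' l)) t := by
  have a0 := hasDerivAt_coord hq 0
  have a1 := hasDerivAt_coord hq 1
  have b0 := hasDerivAt_coord hy 0
  have b1 := hasDerivAt_coord hy 1
  have hm := (gap_pos hq1).ne'
  have h := ((hasDerivAt_rad hq hy hq1 hy0).add ((a0.mul b0).add (a1.mul b1))).div
    (((a0.pow 2).add (a1.pow 2)).const_sub 1) hm
  refine h.congr_deriv ?_
  have hR := (rad_pos hq1 hy0).ne'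
  have h1 := gap_mul_funkStd (y := y t) hq1
  have h2 := rad_sq (y := y t) hq1
  have h3 := funkStd_quadratic (y := y t) hq1
  have h4 := funkStd_radial (y := y t) hq1
  simp only [Fin.sum_univ_two, funkDeriv]
  unfold radSq at h2
  simp only [Pi.add_apply, Pi.mul_apply, Pi.pow_apply, ← h1]
  simp
  generalize rad (q t) (y t) = R at *
  generalize funkStd (q t) (y t) = F at *
  generalize q t 0 = q0 at *
  generalize q t 1 = q1 at *
  generalize y t 0 = y0 at *
  generalize y t 1 = y1 at *
  field_simp
  linear_combination (-(q0 * y' 0 + q1 * y' 1) - (y0 * q' 0 + y1 * q' 1)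
    - 2 * F * (q0 * q' 0 + q1 * q' 1)) * h1 - (q0 * q' 0 + q1 * q' 1) * h3

/-- `R = F - ⟨q, η⟩`. -/
lemma rad_eq {q y : E 2} (hq : ‖q‖ < 1) :
    rad q y = funkStd q y - (q 0 * (funkStd q y * q 0 + y 0) + q 1 * (funkStd q y * q 1 + y 1)) := by
  linear_combination - gap_mul_funkStd (y := y) hq

/-- Differentiating R = (1 - |q|²)F - ⟨q, y⟩ instead of the square root reuses the derivative of F.
-/
lemma hasDerivAt_rad' (hq : HasDerivAt q q' t) (hy : HasDerivAt y y' t) (hq1 : ‖q t‖ < 1)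
    (hy0 : y t ≠ 0) :
    HasDerivAt (fun s => rad (q s) (y s))
      ((1 - (q t 0 ^ 2 + q t 1 ^ 2)) *
          (∑ l, funkDeriv (q t) (y t) l * (y' l + funkStd (q t) (y t) * q' l))
        - 2 * funkStd (q t) (y t) * (q t 0 * q' 0 + q t 1 * q' 1)
        - (q' 0 * y t 0 + q t 0 * y' 0 + (q' 1 * y t 1 + q t 1 * y' 1))) t := by
  have a0 := hasDerivAt_coord hq 0
  have a1 := hasDerivAt_coord hq 1
  have b0 := hasDerivAt_coord hy 0
  have b1 := hasDerivAt_coord hy 1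
  have h := ((((a0.pow 2).add (a1.pow 2)).const_sub 1).mul (hasDerivAt_funkStd hq hy hq1 hy0)).sub
    ((a0.mul b0).add (a1.mul b1))
  have hev : ∀ᶠ s in nhds t, ‖q s‖ < 1 :=
    (hq.continuousAt.norm).eventually_lt continuousAt_const hq1
  refine (h.congr_of_eventuallyEq ?_).congr_deriv ?_
  · filter_upwards [hev] with s hs
    have := gap_mul_funkStd (y := y s) hs
    simp
    linarith
  · simp
    ring

/-- By homogeneity the fibre Hessian of F annihilates y, so in dimension two it is a multiple of Jy
⊗ Jy; the factor is 1/R³. Differentiating Okada's relation in y^k yields the remaining term F_{y^k}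
F_{y^l} q'^l. -/
lemma hasDerivAt_funkDeriv (hq : HasDerivAt q q' t) (hy : HasDerivAt y y' t) (hq1 : ‖q t‖ < 1)
    (hy0 : y t ≠ 0) (k : Fin 2) :
    HasDerivAt (fun s => funkDeriv (q s) (y s) k)
      (rotation (y t) k * (∑ l, rotation (y t) l * (y' l + funkStd (q t) (y t) * q' l))
          / rad (q t) (y t) ^ 3
        + funkDeriv (q t) (y t) k * ∑ l, funkDeriv (q t) (y t) l * q' l) t := by
  have hR := (rad_pos hq1 hy0).ne'
  have h := (((hasDerivAt_funkStd hq hy hq1 hy0).mul (hasDerivAt_coord hq k)).add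
    (hasDerivAt_coord hy k)).div (hasDerivAt_rad' hq hy hq1 hy0) hR
  refine h.congr_deriv ?_
  have h1 := rad_eq (y := y t) hq1
  have h2 := funkStd_quadratic (y := y t) hq1
  simp only [Fin.sum_univ_two, funkDeriv, rotation, Pi.add_apply, Pi.mul_apply]
  clear h
  revert hR h1 h2
  generalize rad (q t) (y t) = R
  generalize funkStd (q t) (y t) = F
  intro hR h1 h2
  obtain rfl | rfl : k = 0 ∨ k = 1 := by fin_cases k <;> simp
  all_goals
    simp
    field_simp
    generalize q t 0 = q0 at *
    generalize q t 1 = q1 at *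
    generalize y t 0 = y0 at *
    generalize y t 1 = y1 at *
    -- In the variables q, η = Fq + y, F, the radical R becomes a polynomial and the only relation
    -- left is |η|² = F². The later curvature identities are handled by the same substitution.
    obtain ⟨n0, h0⟩ : ∃ n0, n0 = F * q0 + y0 := ⟨_, rfl⟩
    obtain ⟨n1, h01⟩ : ∃ n1, n1 = F * q1 + y1 := ⟨_, rfl⟩
    rw [← h0, ← h01] at h1 h2
    obtain rfl : y0 = n0 - F * q0 := by linarith
    obtain rfl : y1 = n1 - F * q1 := by linarith
    subst h1
    clear hR h0 h01 hy0 hy hq1 hq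
    generalize y' 0 = u0 at *
    generalize y' 1 = u1 at *
    generalize q' 0 = p0 at *
    generalize q' 1 = p1 at *
    grind

end

section

/-! ### The perturbed base point -/

/-- The point `x - ε v_x`, at which the Funk metric has to be taken. -/
def drift (ε : ℝ) (x : E 2) : E 2 := x - ε • rotation x

@[simp] lemma rotation_zero_coord (x : E 2) : rotation x 0 = -x 1 := rfl
@[simp] lemma rotation_one_coord (x : E 2) : rotation x 1 = x 0 := rfl

@[simp] lemma drift_zero_coord (ε : ℝ) (x : E 2) : drift ε x 0 = x 0 + ε * x 1 := by
  simp [drift]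

@[simp] lemma drift_one_coord (ε : ℝ) (x : E 2) : drift ε x 1 = x 1 - ε * x 0 := by
  simp [drift]

lemma norm_drift_sq (ε : ℝ) (x : E 2) : ‖drift ε x‖ ^ 2 = (1 + ε ^ 2) * ‖x‖ ^ 2 := by
  rw [norm_sq_eq, norm_sq_eq]; simp; ring

/-- The similarity ratio √(1+ε²) of `drift` is the inverse of the radius, so the Funk metric can be
evaluated at the drifted point exactly on this disk. -/
lemma mem_disk_iff {ε : ℝ} {x : E 2} : x ∈ disk ε ↔ ‖drift ε x‖ < 1 := by
  have h : 0 < 1 + ε ^ 2 := by positivity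
  rw [disk, mem_ball_zero_iff, lt_div_iff₀ (Real.sqrt_pos.2 h),
    ← sq_lt_one_iff₀ (by positivity), ← sq_lt_one_iff₀ (norm_nonneg (drift ε x)), norm_drift_sq,
    mul_pow, Real.sq_sqrt h.le, mul_comm]

lemma isOpen_disk (ε : ℝ) : IsOpen (disk ε) := Metric.isOpen_ball

lemma norm_lt_one_of_mem_disk {ε : ℝ} {x : E 2} (hx : x ∈ disk ε) : ‖x‖ < 1 := by
  have h := mem_disk_iff.1 hx
  rw [← sq_lt_one_iff₀ (norm_nonneg _), norm_drift_sq] at h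
  rw [← sq_lt_one_iff₀ (norm_nonneg _)]
  nlinarith [sq_nonneg ε, sq_nonneg ‖x‖]

lemma drift_add_smul (ε s : ℝ) (x v : E 2) : drift ε (x + s • v) = drift ε x + s • drift ε v := by
  ext i; fin_cases i <;> simp <;> ring

lemma hasDerivAt_line (x v : E 2) : HasDerivAt (fun s : ℝ => x + s • v) v 0 := by
  simpa using ((hasDerivAt_id (0 : ℝ)).smul_const v).const_add x

lemma hasDerivAt_drift_line (ε : ℝ) (x v : E 2) :
    HasDerivAt (fun s : ℝ => drift ε (x + s • v)) (drift ε v) 0 := by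
  simpa only [drift_add_smul] using hasDerivAt_line (drift ε x) (drift ε v)

/-! ### Partial derivatives -/

/-- The `i`-th coordinate vector. -/
abbrev basisVec (i : Fin 2) : E 2 := EuclideanSpace.single i 1

lemma pd_congr {f g : E 2 → ℝ} {x : E 2} (h : f =ᶠ[nhds x] g) (i : Fin 2) : pd i f x = pd i g x :=
  h.lineDeriv_eq

lemma pd_eq {f : E 2 → ℝ} {f' : ℝ} {x : E 2} {i : Fin 2}
    (h : HasDerivAt (fun s : ℝ => f (x + s • basisVec i)) f' 0) : pd i f x = f' := h.deriv

/-! ### The fundamental tensor -/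

/-- The fundamental tensor of the Funk metric. -/
def funkTensor (q y : E 2) (i j : Fin 2) : ℝ :=
  funkDeriv q y i * funkDeriv q y j + funkStd q y * (rotation y i * rotation y j / rad q y ^ 3)

section Curve
variable {q y : ℝ → E 2} {q' y' : E 2} {t : ℝ}

lemma hasDerivAt_funkStd_mul_funkDeriv (hq : HasDerivAt q q' t) (hy : HasDerivAt y y' t)
    (hq1 : ‖q t‖ < 1) (hy0 : y t ≠ 0) (k : Fin 2) :
    HasDerivAt (fun s => funkStd (q s) (y s) * funkDeriv (q s) (y s) k)
      ((∑ l, funkDeriv (q t) (y t) l * (y' l + funkStd (q t) (y t) * q' l))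
          * funkDeriv (q t) (y t) k
        + funkStd (q t) (y t) *
          (rotation (y t) k * (∑ l, rotation (y t) l * (y' l + funkStd (q t) (y t) * q' l))
            / rad (q t) (y t) ^ 3
          + funkDeriv (q t) (y t) k * ∑ l, funkDeriv (q t) (y t) l * q' l)) t :=
  (hasDerivAt_funkStd hq hy hq1 hy0).mul (hasDerivAt_funkDeriv hq hy hq1 hy0 k)

lemma hasDerivAt_rotation_coord (hy : HasDerivAt y y' t) (i : Fin 2) :
    HasDerivAt (fun s => rotation (y s) i) (rotation y' i) t := by
  obtain rfl | rfl : i = 0 ∨ i = 1 := by fin_cases i <;> simp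
  · simpa using (hasDerivAt_coord hy 1).fun_neg
  · simpa using hasDerivAt_coord hy 0

lemma differentiableAt_funkTensor (hq : HasDerivAt q q' t) (hy : HasDerivAt y y' t)
    (hq1 : ‖q t‖ < 1) (hy0 : y t ≠ 0) (i j : Fin 2) :
    DifferentiableAt ℝ (fun s => funkTensor (q s) (y s) i j) t := by
  have hF := (hasDerivAt_funkStd hq hy hq1 hy0).differentiableAt
  have hD := fun k => (hasDerivAt_funkDeriv hq hy hq1 hy0 k).differentiableAt
  have hR := (hasDerivAt_rad hq hy hq1 hy0).differentiableAt
  have hr := fun k => (hasDerivAt_rotation_coord hy k).differentiableAt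
  have h0 := pow_ne_zero 3 (rad_pos hq1 hy0).ne'
  exact ((hD i).mul (hD j)).add (hF.mul (((hr i).mul (hr j)).div (hR.pow 3) h0))

end Curve

/-- Euler's relation F_{y^p} y^p = F, together with Jy ⊥ y, which kills the Hessian part. -/
lemma sum_funkTensor_mul {q y : E 2} (hq : ‖q‖ < 1) (hy : y ≠ 0) (k : Fin 2) :
    ∑ p, funkTensor q y p k * y p = funkStd q y * funkDeriv q y k := by
  have hR := (rad_pos hq hy).ne'
  have h := funkStd_radial (y := y) hq
  have : funkDeriv q y 0 * y 0 + funkDeriv q y 1 * y 1 = funkStd q y := by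
    simp only [funkDeriv]; field_simp; linear_combination h
  simp only [Fin.sum_univ_two, funkTensor, rotation_zero_coord, rotation_one_coord]
  linear_combination funkDeriv q y k * this

lemma pd_funkStd {q y : E 2} (hq : ‖q‖ < 1) (hy : y ≠ 0) (i : Fin 2) :
    pd i (funkStd q) y = funkDeriv q y i := by
  rw [pd_eq (hasDerivAt_funkStd (hasDerivAt_const 0 q) (hasDerivAt_line y (basisVec i)) hq
    (by simpa using hy))]
  simp

lemma pd_funkStd_sq {q y : E 2} (hq : ‖q‖ < 1) (hy : y ≠ 0) (i : Fin 2) :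
    pd i (fun z => funkStd q z ^ 2) y = 2 * (funkStd q y * funkDeriv q y i) := by
  rw [pd_eq (f := fun z => funkStd q z ^ 2) ((hasDerivAt_funkStd (hasDerivAt_const 0 q)
    (hasDerivAt_line y (basisVec i)) hq (by simpa using hy)).fun_pow 2)]
  simp
  ring

lemma fundTensor_eq {F : E 2 → E 2 → ℝ} {x q y : E 2} (hF : ∀ y, F x y = funkStd q y)
    (hq : ‖q‖ < 1) (hy : y ≠ 0) : fundTensor F x y = Matrix.of (funkTensor q y) := by
  ext i j
  simp only [fundTensor, Matrix.of_apply, hF]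
  have hev : (fun w => pd i (fun z => funkStd q z ^ 2) w) =ᶠ[nhds y]
      fun w => 2 * (funkStd q w * funkDeriv q w i) := by
    filter_upwards [isOpen_ne.mem_nhds hy] with w hw
    exact pd_funkStd_sq hq hw i
  rw [pd_congr hev]
  rw [pd_eq (f := fun w => 2 * (funkStd q w * funkDeriv q w i))
    ((hasDerivAt_funkStd_mul_funkDeriv (hasDerivAt_const 0 q)
      (hasDerivAt_line y (basisVec j)) hq (by simpa using hy) i).const_mul 2), funkTensor]
  simp
  ring

/-- For a ⊗ a + c b ⊗ b the determinant is c (a × b)². Here c = F/R³, b = Jy, and a × Jy = F_{y^p}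
y^p = F. -/
lemma det_funkTensor {q y : E 2} (hq : ‖q‖ < 1) (hy : y ≠ 0) :
    (Matrix.of (funkTensor q y)).det = (funkStd q y / rad q y) ^ 3 := by
  have hR := (rad_pos hq hy).ne'
  have h := funkStd_radial (y := y) hq
  have : funkDeriv q y 0 * y 0 + funkDeriv q y 1 * y 1 = funkStd q y := by
    simp only [funkDeriv]; field_simp; linear_combination h
  rw [Matrix.det_fin_two]
  simp only [Matrix.of_apply, funkTensor, rotation_zero_coord, rotation_one_coord]
  generalize funkDeriv q y 0 = a at *
  generalize funkDeriv q y 1 = b at *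
  rw [← this]
  field_simp
  ring

lemma posDef_fin_two {M : Matrix (Fin 2) (Fin 2) ℝ} (hs : M 0 1 = M 1 0) (h0 : 0 < M 0 0)
    (hd : 0 < M.det) : M.PosDef := by
  rw [Matrix.posDef_iff_dotProduct_mulVec]
  refine ⟨?_, fun x hx => ?_⟩
  · ext i j
    fin_cases i <;> fin_cases j <;> simp [hs]
  · rw [Matrix.det_fin_two, ← hs] at hd
    simp only [Matrix.mulVec, dotProduct, Fin.sum_univ_two, star_trivial, ← hs]
    -- After multiplication by M₀₀ the quadratic form is (M₀₀x₀ + M₀₁x₁)² + det M · x₁².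
    refine (mul_pos_iff_of_pos_left h0).1 ?_
    by_cases h : x 1 = 0
    · have : x 0 ≠ 0 := fun h' => hx (by ext i; fin_cases i <;> simp [h, h'])
      have := mul_pos (mul_pos h0 h0) (pow_pos (abs_pos.2 this) 2)
      rw [sq_abs] at this
      simp only [h]
      linarith
    · have := mul_pos hd (pow_pos (abs_pos.2 h) 2)
      rw [sq_abs] at this
      nlinarith [sq_nonneg (M 0 0 * x 0 + M 0 1 * x 1)]

lemma posDef_funkTensor {q y : E 2} (hq : ‖q‖ < 1) (hy : y ≠ 0) :
    (Matrix.of (funkTensor q y)).PosDef := by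
  have hR := rad_pos hq hy
  have hF := funkStd_pos hq hy
  refine posDef_fin_two ?_ ?_ ?_
  · simp only [Matrix.of_apply, funkTensor]; ring
  · simp only [Matrix.of_apply, funkTensor, rotation_zero_coord]
    by_cases h1 : y 1 = 0
    · have h := funkStd_radial (y := y) hq
      have hd : funkDeriv q y 0 ≠ 0 := by
        intro h0
        rw [funkDeriv, div_eq_zero_iff, or_iff_left hR.ne'] at h0
        rw [h0, h1] at h
        nlinarith [mul_pos hF hR]
      rw [h1]
      simpa using hd
    · have : 0 < funkStd q y * (-y 1 * -y 1 / rad q y ^ 3) := by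
        rw [neg_mul_neg]
        exact mul_pos hF (div_pos (mul_self_pos.2 h1) (pow_pos hR 3))
      nlinarith [mul_self_nonneg (funkDeriv q y 0)]
  · rw [det_funkTensor hq hy]; positivity

/-! ### The geodesic coefficients -/

/-- The geodesic coefficients of the perturbed Funk metric, in terms of the base point
`q = drift ε x`. -/
def spray (ε : ℝ) (q y : E 2) (i : Fin 2) : ℝ :=
  funkStd q y * (y i / 2 - ε * rotation y i) - ε / 2 * funkStd q y ^ 2 * rotation q i

/-- `F` is the perturbed Funk metric on the disk. -/
def IsPerturbed (ε : ℝ) (F : E 2 → E 2 → ℝ) : Prop :=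
  ∀ x ∈ disk ε, ∀ y, F x y = funkStd (drift ε x) y

/-- The derivative of `F F_{yᵏ}` in the `j`-th coordinate of the base point. -/
def mixedDeriv (ε : ℝ) (q y : E 2) (j k : Fin 2) : ℝ :=
  2 * funkStd q y * funkDeriv q y k * (∑ l, funkDeriv q y l * drift ε (basisVec j) l)
    + funkStd q y ^ 2 * rotation y k * (∑ l, rotation y l * drift ε (basisVec j) l)
      / rad q y ^ 3

/-- Contraction with the fixed vector y commutes with ∂/∂x^j, so F F_{y^k} can be differentiated in
place of the tensor entries, for which differentiability suffices. -/
lemma sum_pd_fundTensor {ε : ℝ} {F : E 2 → E 2 → ℝ} (hF : IsPerturbed ε F) {x y : E 2}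
    (hx : x ∈ disk ε) (hy : y ≠ 0) (j k : Fin 2) :
    ∑ p, pd j (fun z => fundTensor F z y p k) x * y p = mixedDeriv ε (drift ε x) y j k := by
  have hev : ∀ p, (fun z => fundTensor F z y p k) =ᶠ[nhds x]
      fun z => funkTensor (drift ε z) y p k := fun p => by
    filter_upwards [(isOpen_disk ε).mem_nhds hx] with z hz
    rw [fundTensor_eq (hF z hz) (mem_disk_iff.1 hz) hy, Matrix.of_apply]
  have h1 : ∀ p, HasDerivAt (fun s : ℝ => funkTensor (drift ε (x + s • basisVec j)) y p k)
      (pd j (fun z => fundTensor F z y p k) x) 0 := fun p => by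
    rw [pd_congr (hev p)]
    exact (differentiableAt_funkTensor (hasDerivAt_drift_line ε x (basisVec j))
      (hasDerivAt_const 0 y) (by simpa using mem_disk_iff.1 hx) hy p k).hasDerivAt
  have h2 := HasDerivAt.fun_sum (u := Finset.univ) fun p _ => (h1 p).mul_const (y p)
  have h3 := hasDerivAt_funkStd_mul_funkDeriv (hasDerivAt_drift_line ε x (basisVec j))
      (hasDerivAt_const 0 y) (by simpa using mem_disk_iff.1 hx) hy k
  have hev2 : ∀ᶠ s : ℝ in nhds 0, x + s • basisVec j ∈ disk ε := by
    have : ContinuousAt (fun s : ℝ => x + s • basisVec j) 0 := (hasDerivAt_line x _).continuousAt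
    exact this.eventually_mem ((isOpen_disk ε).mem_nhds (by simpa using hx))
  have h4 := h2.congr_of_eventuallyEq (f₁ := fun s : ℝ =>
    funkStd (drift ε (x + s • basisVec j)) y * funkDeriv (drift ε (x + s • basisVec j)) y k) (by
      filter_upwards [hev2] with s hs
      exact (sum_funkTensor_mul (mem_disk_iff.1 hs) hy k).symm)
  rw [h4.unique h3, mixedDeriv]
  simp only [zero_smul, add_zero, Fin.sum_univ_two, PiLp.zero_apply, zero_add]
  ring

/-- The geodesic equation with its index lowered: both sides equal 4 g_{kj} G^j, so `spray` is
verified without inverting g. -/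
lemma spray_identity {ε : ℝ} {q y : E 2} (hq : ‖q‖ < 1) (hy : y ≠ 0) (k : Fin 2) :
    2 * ∑ j, mixedDeriv ε q y j k * y j - ∑ j, mixedDeriv ε q y k j * y j =
      4 * ∑ j, funkTensor q y k j * spray ε q y j := by
  have hR := (rad_pos hq hy).ne'
  have h1 := rad_eq (y := y) hq
  have h2 := funkStd_quadratic (y := y) hq
  simp only [Fin.sum_univ_two, mixedDeriv, funkTensor, spray, funkDeriv]
  clear hq hy
  revert hR h1 h2
  generalize rad q y = R
  generalize funkStd q y = F
  intro hR h1 h2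
  obtain rfl | rfl : k = 0 ∨ k = 1 := by fin_cases k <;> simp
  all_goals
    simp
    generalize q 0 = q0 at *
    generalize q 1 = q1 at *
    generalize y 0 = y0 at *
    generalize y 1 = y1 at *
    obtain ⟨n0, h0⟩ : ∃ n0, n0 = F * q0 + y0 := ⟨_, rfl⟩
    obtain ⟨n1, h01⟩ : ∃ n1, n1 = F * q1 + y1 := ⟨_, rfl⟩
    rw [← h0, ← h01] at h1 h2
    obtain rfl : y0 = n0 - F * q0 := by linarith
    obtain rfl : y1 = n1 - F * q1 := by linarith
    field_simp
    subst h1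
    clear hR h0 h01
    grind

lemma geodCoeff_eq {ε : ℝ} {F : E 2 → E 2 → ℝ} (hF : IsPerturbed ε F) {x y : E 2}
    (hx : x ∈ disk ε) (hy : y ≠ 0) (i : Fin 2) :
    geodCoeff F i x y = spray ε (drift ε x) y i := by
  have hq := mem_disk_iff.1 hx
  have hV : ∀ k, ∑ p, ∑ j, (2 * pd j (fun z => fundTensor F z y p k) x
      - pd k (fun z => fundTensor F z y p j) x) * y p * y j =
      (Matrix.of (funkTensor (drift ε x) y)).mulVec (fun j => 4 * spray ε (drift ε x) y j) k := by
    intro k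
    have e := spray_identity (ε := ε) hq hy k
    simp only [← sum_pd_fundTensor hF hx hy] at e
    have e2 : (Matrix.of (funkTensor (drift ε x) y)).mulVec
        (fun j => 4 * spray ε (drift ε x) y j) k =
        4 * ∑ j, funkTensor (drift ε x) y k j * spray ε (drift ε x) y j := by
      simp [Matrix.mulVec, dotProduct, Fin.sum_univ_two]; ring
    rw [e2, ← e]
    simp only [Fin.sum_univ_two]
    ring
  have hdet : IsUnit (Matrix.of (funkTensor (drift ε x) y)).det := by
    rw [det_funkTensor hq hy, isUnit_iff_ne_zero]
    exact pow_ne_zero 3 (div_pos (funkStd_pos hq hy) (rad_pos hq hy)).ne'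
  have hs : ∑ k, (fundTensor F x y)⁻¹ i k * ∑ p, ∑ j, (2 * pd j (fun z => fundTensor F z y p k) x
      - pd k (fun z => fundTensor F z y p j) x) * y p * y j =
      (fundTensor F x y)⁻¹.mulVec ((Matrix.of (funkTensor (drift ε x) y)).mulVec
        (fun j => 4 * spray ε (drift ε x) y j)) i := by
    simp only [hV]; rfl
  rw [geodCoeff, hs, fundTensor_eq (hF x hx) hq hy, Matrix.mulVec_mulVec,
    Matrix.nonsing_inv_mul _ hdet, Matrix.one_mulVec]
  ring

end

section

/-! ### Curvature of the perturbed metric -/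

/-- The derivative of the `i`-th geodesic coefficient in the `k`-th fibre coordinate. -/
def sprayDeriv (ε : ℝ) (q y : E 2) (i k : Fin 2) : ℝ :=
  funkDeriv q y k * (y i / 2 - ε * rotation y i - ε * (funkStd q y * rotation q i))
    + funkStd q y * (basisVec k i / 2 - ε * rotation (basisVec k) i)

section Curve
variable {q y : ℝ → E 2} {q' y' : E 2} {t : ℝ}

lemma hasDerivAt_spray (ε : ℝ) (hq : HasDerivAt q q' t) (hy : HasDerivAt y y' t)
    (hq1 : ‖q t‖ < 1) (hy0 : y t ≠ 0) (i : Fin 2) :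
    HasDerivAt (fun s => spray ε (q s) (y s) i)
      ((∑ l, funkDeriv (q t) (y t) l * (y' l + funkStd (q t) (y t) * q' l))
          * (y t i / 2 - ε * rotation (y t) i - ε * (funkStd (q t) (y t) * rotation (q t) i))
        + funkStd (q t) (y t) * (y' i / 2 - ε * rotation y' i)
        - ε / 2 * funkStd (q t) (y t) ^ 2 * rotation q' i) t := by
  have hF := hasDerivAt_funkStd hq hy hq1 hy0
  have h := (hF.fun_mul (((hasDerivAt_coord hy i).div_const 2).fun_sub
    ((hasDerivAt_rotation_coord hy i).const_mul ε))).fun_sub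
    (((hF.fun_pow 2).const_mul (ε / 2)).fun_mul (hasDerivAt_rotation_coord hq i))
  refine h.congr_deriv ?_
  simp
  ring

lemma hasDerivAt_sprayDeriv (ε : ℝ) (hq : HasDerivAt q q' t) (hy : HasDerivAt y y' t)
    (hq1 : ‖q t‖ < 1) (hy0 : y t ≠ 0) (i k : Fin 2) :
    HasDerivAt (fun s => sprayDeriv ε (q s) (y s) i k)
      ((rotation (y t) k * (∑ l, rotation (y t) l * (y' l + funkStd (q t) (y t) * q' l))
            / rad (q t) (y t) ^ 3
          + funkDeriv (q t) (y t) k * ∑ l, funkDeriv (q t) (y t) l * q' l)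
          * (y t i / 2 - ε * rotation (y t) i - ε * (funkStd (q t) (y t) * rotation (q t) i))
        + funkDeriv (q t) (y t) k * (y' i / 2 - ε * rotation y' i
          - ε * ((∑ l, funkDeriv (q t) (y t) l * (y' l + funkStd (q t) (y t) * q' l))
              * rotation (q t) i + funkStd (q t) (y t) * rotation q' i))
        + (∑ l, funkDeriv (q t) (y t) l * (y' l + funkStd (q t) (y t) * q' l))
          * (basisVec k i / 2 - ε * rotation (basisVec k) i)) t := by
  have hF := hasDerivAt_funkStd hq hy hq1 hy0
  have hD := hasDerivAt_funkDeriv hq hy hq1 hy0 k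
  exact (hD.fun_mul ((((hasDerivAt_coord hy i).div_const 2).fun_sub
    ((hasDerivAt_rotation_coord hy i).const_mul ε)).fun_sub
    ((hF.fun_mul (hasDerivAt_rotation_coord hq i)).const_mul ε))).fun_add
    (hF.mul_const (basisVec k i / 2 - ε * rotation (basisVec k) i))

end Curve

/-! ### Derivatives of the geodesic coefficients and the flag curvature -/

section Values
variable {ε : ℝ} {F : E 2 → E 2 → ℝ} {x y : E 2}

/-- The derivative of the `i`-th geodesic coefficient in the `j`-th base coordinate. -/
def sprayBaseDeriv (ε : ℝ) (q y : E 2) (i j : Fin 2) : ℝ :=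
  funkStd q y * (∑ l, funkDeriv q y l * drift ε (basisVec j) l)
      * (y i / 2 - ε * rotation y i - ε * (funkStd q y * rotation q i))
    - ε / 2 * funkStd q y ^ 2 * rotation (drift ε (basisVec j)) i

/-- The derivative of `∂Gⁱ/∂yᵏ` in the `j`-th fibre coordinate. -/
def sprayHess (ε : ℝ) (q y : E 2) (i k j : Fin 2) : ℝ :=
  rotation y k * rotation y j / rad q y ^ 3
      * (y i / 2 - ε * rotation y i - ε * (funkStd q y * rotation q i))
    + funkDeriv q y k * (basisVec j i / 2 - ε * rotation (basisVec j) i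
      - ε * (funkDeriv q y j * rotation q i))
    + funkDeriv q y j * (basisVec k i / 2 - ε * rotation (basisVec k) i)

/-- The derivative of `∂Gⁱ/∂yᵏ` in the `j`-th base coordinate. -/
def sprayMixed (ε : ℝ) (q y : E 2) (i k j : Fin 2) : ℝ :=
  (funkStd q y * rotation y k * (∑ l, rotation y l * drift ε (basisVec j) l) / rad q y ^ 3
      + funkDeriv q y k * ∑ l, funkDeriv q y l * drift ε (basisVec j) l)
      * (y i / 2 - ε * rotation y i - ε * (funkStd q y * rotation q i))
    - ε * funkDeriv q y k * (funkStd q y * (∑ l, funkDeriv q y l * drift ε (basisVec j) l)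
          * rotation q i + funkStd q y * rotation (drift ε (basisVec j)) i)
    + funkStd q y * (∑ l, funkDeriv q y l * drift ε (basisVec j) l)
      * (basisVec k i / 2 - ε * rotation (basisVec k) i)

lemma pd_fibre_geodCoeff (hF : IsPerturbed ε F) (hx : x ∈ disk ε) (hy : y ≠ 0) (i k : Fin 2) :
    pd k (fun w => geodCoeff F i x w) y = sprayDeriv ε (drift ε x) y i k := by
  have hev : (fun w => geodCoeff F i x w) =ᶠ[nhds y] fun w => spray ε (drift ε x) w i := by
    filter_upwards [isOpen_ne.mem_nhds hy] with w hw using geodCoeff_eq hF hx hw i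
  rw [pd_congr hev, pd_eq (f := fun w => spray ε (drift ε x) w i)
    (hasDerivAt_spray ε (hasDerivAt_const 0 _) (hasDerivAt_line y _) (mem_disk_iff.1 hx)
      (by simpa using hy) i), sprayDeriv]
  have : rotation (0 : E 2) i = 0 := by fin_cases i <;> simp
  simp [this]

lemma pd_base_geodCoeff (hF : IsPerturbed ε F) (hx : x ∈ disk ε) (hy : y ≠ 0) (i j : Fin 2) :
    pd j (fun z => geodCoeff F i z y) x = sprayBaseDeriv ε (drift ε x) y i j := by
  have hev : (fun z => geodCoeff F i z y) =ᶠ[nhds x] fun z => spray ε (drift ε z) y i := by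
    filter_upwards [(isOpen_disk ε).mem_nhds hx] with z hz using geodCoeff_eq hF hz hy i
  rw [pd_congr hev, pd_eq (f := fun z => spray ε (drift ε z) y i)
    (hasDerivAt_spray ε (hasDerivAt_drift_line ε x _) (hasDerivAt_const 0 y)
      (by simpa using mem_disk_iff.1 hx) hy i), sprayBaseDeriv]
  have : rotation (0 : E 2) i = 0 := by fin_cases i <;> simp
  simp only [zero_smul, add_zero, Fin.sum_univ_two, PiLp.zero_apply, zero_add, this]
  ring

lemma pd_pd_fibre_geodCoeff (hF : IsPerturbed ε F) (hx : x ∈ disk ε) (hy : y ≠ 0)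
    (i k j : Fin 2) :
    pd j (fun w => pd k (fun w' => geodCoeff F i x w') w) y =
      sprayHess ε (drift ε x) y i k j := by
  have hev : (fun w => pd k (fun w' => geodCoeff F i x w') w) =ᶠ[nhds y]
      fun w => sprayDeriv ε (drift ε x) w i k := by
    filter_upwards [isOpen_ne.mem_nhds hy] with w hw using pd_fibre_geodCoeff hF hx hw i k
  rw [pd_congr hev, pd_eq (f := fun w => sprayDeriv ε (drift ε x) w i k)
    (hasDerivAt_sprayDeriv ε (hasDerivAt_const 0 _) (hasDerivAt_line y _) (mem_disk_iff.1 hx)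
      (by simpa using hy) i k), sprayHess]
  have : rotation (0 : E 2) i = 0 := by fin_cases i <;> simp
  simp [this]

lemma pd_base_pd_fibre_geodCoeff (hF : IsPerturbed ε F) (hx : x ∈ disk ε) (hy : y ≠ 0)
    (i k j : Fin 2) :
    pd j (fun z => pd k (fun w => geodCoeff F i z w) y) x =
      sprayMixed ε (drift ε x) y i k j := by
  have hev : (fun z => pd k (fun w => geodCoeff F i z w) y) =ᶠ[nhds x]
      fun z => sprayDeriv ε (drift ε z) y i k := by
    filter_upwards [(isOpen_disk ε).mem_nhds hx] with z hz using pd_fibre_geodCoeff hF hz hy i k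
  rw [pd_congr hev, pd_eq (f := fun z => sprayDeriv ε (drift ε z) y i k)
    (hasDerivAt_sprayDeriv ε (hasDerivAt_drift_line ε x _) (hasDerivAt_const 0 y)
      (by simpa using mem_disk_iff.1 hx) hy i k), sprayMixed]
  have : rotation (0 : E 2) i = 0 := by fin_cases i <;> simp
  simp only [zero_smul, add_zero, Fin.sum_univ_two, PiLp.zero_apply, zero_add, this]
  ring

lemma flag_identity {q : E 2} (hq : ‖q‖ < 1) (hy : y ≠ 0) (i k : Fin 2) :
    2 * sprayBaseDeriv ε q y i k - ∑ j, y j * sprayMixed ε q y i k j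
      + 2 * ∑ j, spray ε q y j * sprayHess ε q y i k j
      - ∑ j, sprayDeriv ε q y i j * sprayDeriv ε q y j k =
    (-1 / 4) * (funkStd q y ^ 2 * (if i = k then 1 else 0)
      - funkStd q y * funkDeriv q y k * y i) := by
  have hR := (rad_pos hq hy).ne'
  have h1 := rad_eq (y := y) hq
  have h2 := funkStd_quadratic (y := y) hq
  simp only [Fin.sum_univ_two, sprayBaseDeriv, sprayMixed, spray, sprayHess, sprayDeriv, funkDeriv]
  clear hq hy
  revert hR h1 h2
  generalize rad q y = R
  generalize funkStd q y = F
  intro hR h1 h2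
  obtain rfl | rfl : i = 0 ∨ i = 1 := by fin_cases i <;> simp
  all_goals obtain rfl | rfl : k = 0 ∨ k = 1 := by fin_cases k <;> simp
  all_goals
    simp
    generalize q 0 = q0 at *
    generalize q 1 = q1 at *
    generalize y 0 = y0 at *
    generalize y 1 = y1 at *
    obtain ⟨n0, h0⟩ : ∃ n0, n0 = F * q0 + y0 := ⟨_, rfl⟩
    obtain ⟨n1, h01⟩ : ∃ n1, n1 = F * q1 + y1 := ⟨_, rfl⟩
    rw [← h0, ← h01] at h1 h2
    obtain rfl : y0 = n0 - F * q0 := by linarith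
    obtain rfl : y1 = n1 - F * q1 := by linarith
    field_simp
    subst h1
    clear hR h0 h01
    grind

theorem hasConstFlagCurvature (hF : IsPerturbed ε F) :
    HasConstFlagCurvature F (disk ε) (-1 / 4) := by
  intro x hx y hy i k
  have hq := mem_disk_iff.1 hx
  have hd : pd k (fun w => F x w) y = funkDeriv (drift ε x) y k := by
    simp only [hF x hx]
    exact pd_funkStd hq hy k
  rw [hd, hF x hx, riemann]
  simp only [pd_base_pd_fibre_geodCoeff hF hx hy, pd_pd_fibre_geodCoeff hF hx hy,
    pd_base_geodCoeff hF hx hy, pd_fibre_geodCoeff hF hx hy, geodCoeff_eq hF hx hy]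
  exact flag_identity hq hy i k

/-! ### The S-curvature -/

/-- The unit ball of F at x is a translate of the Euclidean unit ball, with centre -q. -/
lemma bhDensity_eq_one (hF : IsPerturbed ε F) (hx : x ∈ disk ε) : bhDensity F x = 1 := by
  have hs : {y : E 2 | F x y < 1} = Metric.ball (-drift ε x) 1 := by
    ext y
    rw [mem_ofPred_eq, hF x hx, funkStd_lt_one_iff (mem_disk_iff.1 hx), mem_ball_iff_norm,
      sub_neg_eq_add, add_comm]
  rw [bhDensity, hs, MeasureTheory.Measure.addHaar_ball_center MeasureTheory.volume (-drift ε x)]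
  refine div_self (ENNReal.toReal_pos ?_ ?_).ne'
  · exact (Metric.measure_ball_pos _ _ one_pos).ne'
  · exact MeasureTheory.measure_ball_lt_top.ne

/-- As σ = 1 is locally constant, S is the fibre divergence of G. The terms in ε vanish since ⟨η,
J(y + Fq)⟩ = ⟨η, Jη⟩ = 0 and J has trace zero; Euler's relation gives F/2, and the divergence of y/2
times F gives F. -/
theorem sCurvature_eq (hF : IsPerturbed ε F) (hx : x ∈ disk ε) (hy : y ≠ 0) :
    sCurvature F x y = 3 / 2 * F x y := by
  have hev : bhDensity F =ᶠ[nhds x] fun _ => 1 := by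
    filter_upwards [(isOpen_disk ε).mem_nhds hx] with z hz using bhDensity_eq_one hF hz
  have h0 : ∀ i, pd i (bhDensity F) x = 0 := fun i => by
    rw [pd_congr hev]
    exact pd_eq (hasDerivAt_const 0 _)
  have hq := mem_disk_iff.1 hx
  have hR := (rad_pos hq hy).ne'
  have h1 := rad_eq (y := y) hq
  have h2 := funkStd_quadratic (y := y) hq
  have h3 := funkStd_radial (y := y) hq
  simp only [sCurvature, h0, mul_zero, Finset.sum_const_zero, sub_zero,
    pd_fibre_geodCoeff hF hx hy, hF x hx, sprayDeriv, Fin.sum_univ_two, funkDeriv]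
  clear hq h0
  simp
  revert hR h1 h2 h3
  generalize rad (drift ε x) y = R
  generalize funkStd (drift ε x) y = F
  simp
  intro hR h1 h2 h3
  field_simp
  linear_combination h3

end Values

end

section

/-! ### The perturbed metric is a Randers metric -/

/-- Since p + (y/t - εJp) = q + y/t, both conditions say that this point lies on the unit circle. -/
lemma funk_sub_eq_one_iff {ε t : ℝ} {p : E 2} (hp : p ∈ disk ε) (y : E 2) (ht : 0 < t) :
    funk p (t⁻¹ • y - ε • rotation p) = 1 ↔ t = funkStd (drift ε p) y := by
  have hp1 := norm_lt_one_of_mem_disk hp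
  have e : p + (t⁻¹ • y - ε • rotation p) = drift ε p + t⁻¹ • y := by
    rw [drift]; abel
  rw [funk_eq_funkStd hp1, funkStd_eq_one_iff hp1, e, ← funkStd_eq_one_iff (mem_disk_iff.1 hp),
    funkStd_smul _ _ (inv_pos.2 ht), inv_mul_eq_one₀ ht.ne']

theorem existsUnique_perturbation {ε : ℝ} {p : E 2} (hp : p ∈ disk ε) {y : E 2} (hy : y ≠ 0) :
    ∃! t : ℝ, 0 < t ∧ funk p (t⁻¹ • y - ε • rotation p) = 1 := by
  have h := funkStd_pos (mem_disk_iff.1 hp) hy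
  exact ⟨_, ⟨h, (funk_sub_eq_one_iff hp y h).2 rfl⟩,
    fun t ht => (funk_sub_eq_one_iff hp y ht.1).1 ht.2⟩

lemma IsFunkPerturbation.isPerturbed {ε : ℝ} {F : E 2 → E 2 → ℝ} (hF : IsFunkPerturbation ε F) :
    IsPerturbed ε F := by
  intro p hp y
  by_cases hy : y = 0
  · rw [hy, (hF p hp).1, funkStd_zero]
  · obtain ⟨h0, h1⟩ := (hF p hp).2 y hy
    exact (funk_sub_eq_one_iff hp y h0).1 h1

/-- The Riemannian part of the perturbed Funk metric. -/
def randersA (ε : ℝ) (x : E 2) : Matrix (Fin 2) (Fin 2) ℝ :=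
  Matrix.of fun i j => (if i = j then 1 else 0) / (1 - (drift ε x 0 ^ 2 + drift ε x 1 ^ 2))
    + drift ε x i * drift ε x j / (1 - (drift ε x 0 ^ 2 + drift ε x 1 ^ 2)) ^ 2

/-- The linear part of the perturbed Funk metric. -/
def randersB (ε : ℝ) (x : E 2) (i : Fin 2) : ℝ :=
  drift ε x i / (1 - (drift ε x 0 ^ 2 + drift ε x 1 ^ 2))

lemma alpha_randersA {ε : ℝ} {x : E 2} (hx : x ∈ disk ε) (y : E 2) :
    alpha (randersA ε) x y =
      rad (drift ε x) y / (1 - (drift ε x 0 ^ 2 + drift ε x 1 ^ 2)) := by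
  have hq := mem_disk_iff.1 hx
  have hm := gap_pos hq
  have hs := Real.sqrt_sq (div_nonneg (Real.sqrt_nonneg _) hm.le :
    0 ≤ rad (drift ε x) y / (1 - (drift ε x 0 ^ 2 + drift ε x 1 ^ 2)))
  rw [alpha, ← hs, div_pow, rad_sq hq, radSq]
  congr 1
  simp only [randersA, Fin.sum_univ_two, Matrix.of_apply]
  revert hm
  generalize drift ε x 0 = q0
  generalize drift ε x 1 = q1
  intro hm
  simp
  field_simp
  ring

lemma beta_randersB (ε : ℝ) (x y : E 2) :
    beta (randersB ε) x y =
      (drift ε x 0 * y 0 + drift ε x 1 * y 1) / (1 - (drift ε x 0 ^ 2 + drift ε x 1 ^ 2)) := by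
  simp only [beta, randersB, Fin.sum_univ_two]
  ring

lemma det_randersA {ε : ℝ} {x : E 2} (hx : x ∈ disk ε) :
    (randersA ε x).det = 1 / (1 - (drift ε x 0 ^ 2 + drift ε x 1 ^ 2)) ^ 3 := by
  have hm := gap_pos (mem_disk_iff.1 hx)
  rw [Matrix.det_fin_two]
  simp only [randersA, Matrix.of_apply]
  revert hm
  generalize drift ε x 0 = q0
  generalize drift ε x 1 = q1
  intro hm
  simp
  field_simp
  ring

lemma contDiff_coord (i : Fin 2) : ContDiff ℝ ∞ (fun x : E 2 => x i) :=
  (EuclideanSpace.proj (𝕜 := ℝ) i).contDiff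

lemma contDiff_drift_coord (ε : ℝ) (i : Fin 2) : ContDiff ℝ ∞ (fun x : E 2 => drift ε x i) := by
  obtain rfl | rfl : i = 0 ∨ i = 1 := by fin_cases i <;> simp
  · simp only [drift_zero_coord]
    exact (contDiff_coord 0).add (contDiff_const.mul (contDiff_coord 1))
  · simp only [drift_one_coord]
    exact (contDiff_coord 1).sub (contDiff_const.mul (contDiff_coord 0))

lemma contDiff_gap (ε : ℝ) :
    ContDiff ℝ ∞ (fun x : E 2 => 1 - (drift ε x 0 ^ 2 + drift ε x 1 ^ 2)) :=
  contDiff_const.sub (((contDiff_drift_coord ε 0).pow 2).add ((contDiff_drift_coord ε 1).pow 2))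

lemma contDiffOn_funkStd_drift (ε : ℝ) :
    ContDiffOn ℝ ∞ (fun p : E 2 × E 2 => funkStd (drift ε p.1) p.2) (disk ε ×ˢ {0}ᶜ) := by
  have hq := fun i => (contDiff_drift_coord ε i).comp (contDiff_fst (E := E 2) (F := E 2))
  have hy := fun i => (contDiff_coord i).comp (contDiff_snd (E := E 2) (F := E 2))
  have hm := (contDiff_gap ε).comp (contDiff_fst (E := E 2) (F := E 2))
  have hb := ((hq 0).mul (hy 0)).add ((hq 1).mul (hy 1))
  have hr := (hm.mul (((hy 0).pow 2).add ((hy 1).pow 2))).add (hb.pow 2)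
  exact ((hr.contDiffOn.sqrt fun p hp => (radSq_pos (mem_disk_iff.1 hp.1) hp.2).ne').add
    hb.contDiffOn).div hm.contDiffOn fun p hp => (gap_pos (mem_disk_iff.1 hp.1)).ne'

variable {ε : ℝ} {F : E 2 → E 2 → ℝ}

theorem IsPerturbed.isFinslerMetric (hF : IsPerturbed ε F) : IsFinslerMetric F (disk ε) where
  zero x hx := by rw [hF x hx, funkStd_zero]
  pos x hx y hy := by rw [hF x hx]; exact funkStd_pos (mem_disk_iff.1 hx) hy
  homog x hx y t ht := by rw [hF x hx, hF x hx, funkStd_smul _ _ ht]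
  smooth := (contDiffOn_funkStd_drift ε).congr fun p hp => hF p.1 hp.1 p.2
  convex x hx y hy := by
    rw [fundTensor_eq (hF x hx) (mem_disk_iff.1 hx) hy]
    exact posDef_funkTensor (mem_disk_iff.1 hx) hy

theorem IsPerturbed.isRandersMetric (hF : IsPerturbed ε F) :
    IsRandersMetric F (randersA ε) (randersB ε) (disk ε) where
  finsler := hF.isFinslerMetric
  smooth_a i j := by
    have hm : ∀ x ∈ disk ε, 1 - (drift ε x 0 ^ 2 + drift ε x 1 ^ 2) ≠ 0 :=
      fun x hx => (gap_pos (mem_disk_iff.1 hx)).ne'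
    exact (contDiffOn_const.div (contDiff_gap ε).contDiffOn hm).add
      ((((contDiff_drift_coord ε i).mul (contDiff_drift_coord ε j)).contDiffOn).div
        ((contDiff_gap ε).pow 2).contDiffOn fun x hx => pow_ne_zero 2 (hm x hx))
  posDef_a x hx := by
    have hm := gap_pos (mem_disk_iff.1 hx)
    refine posDef_fin_two ?_ ?_ ?_
    · simp only [randersA, Matrix.of_apply]
      simp; ring
    · simp only [randersA, Matrix.of_apply]
      rw [if_pos trivial]
      have := mul_self_nonneg (drift ε x 0)
      positivity
    · rw [det_randersA hx]
      positivity
  smooth_b i := (contDiff_drift_coord ε i).contDiffOn.div (contDiff_gap ε).contDiffOn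
    fun x hx => (gap_pos (mem_disk_iff.1 hx)).ne'
  norm_lt x hx := by
    have hq := mem_disk_iff.1 hx
    have hm := gap_pos hq
    refine ⟨‖drift ε x‖, hq, fun y => ?_⟩
    rw [alpha_randersA hx, beta_randersB, mul_div_assoc']
    gcongr
    refine (le_abs_self _).trans (abs_le_of_sq_le_sq ?_
      (mul_nonneg (norm_nonneg _) (Real.sqrt_nonneg _)))
    rw [mul_pow, norm_sq_eq, rad_sq hq, radSq]
    -- With m = 1 - |q|², Lagrange's identity gives |q|²R² - ⟨q, y⟩² = m (q × y)².
    have := mul_nonneg hm.le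
      (sq_nonneg (drift ε x 0 * y 1 - drift ε x 1 * y 0))
    linarith
  eq_add x hx y := by
    rw [hF x hx, alpha_randersA hx, beta_randersB, funkStd, add_div]

end

section

/-! ### Projective flatness of the Funk metric -/

lemma drift_zero (x : E 2) : drift 0 x = x := by simp [drift]

lemma exists_const_of_hasDerivAt_zero {G : Type*} [NormedAddCommGroup G] [NormedSpace ℝ G]
    {f : ℝ → G} {s t : ℝ} (h : ∀ r ∈ Ioo s t, HasDerivAt f 0 r) :
    ∃ a, ∀ r ∈ Ioo s t, f r = a :=
  isOpen_Ioo.exists_is_const_of_deriv_eq_zero isPreconnected_Ioo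
    (fun r hr => (h r hr).differentiableAt.differentiableWithinAt) fun r hr => (h r hr).deriv

variable {F : E 2 → E 2 → ℝ}

/-- Geodesics of the Funk metric run inside straight lines. -/
lemma IsGeodesicOn.collinear_image (hF : IsPerturbed 0 F) {c : ℝ → E 2} {s t : ℝ}
    (hU : ∀ r ∈ Ioo s t, c r ∈ disk 0) (hc : IsGeodesicOn F c (Ioo s t)) :
    Collinear ℝ (c '' Ioo s t) := by
  have hq : ∀ r ∈ Ioo s t, ‖c r‖ < 1 := fun r hr => by
    simpa only [drift_zero] using mem_disk_iff.1 (hU r hr)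
  have h1 : ∀ r ∈ Ioo s t, HasDerivAt c (deriv c r) r := fun r hr => (hc r hr).1.hasDerivAt
  have h2 : ∀ r ∈ Ioo s t,
      HasDerivAt (deriv c) (-funkStd (c r) (deriv c r) • deriv c r) r := fun r hr => by
    convert (hc r hr).2.2 using 1
    ext i
    simp [geodCoeff_eq hF (hU r hr) (hc r hr).2.1, spray, drift_zero]
    ring
  -- F is constant along the geodesic: with y = c' and y' = -Fc', the factor y' + Fq' in the
  -- derivative of F vanishes.
  obtain ⟨a, ha⟩ := exists_const_of_hasDerivAt_zero
    (f := fun r => funkStd (c r) (deriv c r)) (s := s) (t := t) fun r hr => by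
      refine (hasDerivAt_funkStd (h1 r hr) (h2 r hr) (hq r hr) (hc r hr).2.1).congr_deriv ?_
      simp
  have h3 : ∀ r ∈ Ioo s t, HasDerivAt (deriv c) (-a • deriv c r) r := fun r hr => by
    have := h2 r hr
    rwa [show funkStd (c r) (deriv c r) = a from ha r hr] at this
  obtain ⟨w, hw⟩ := exists_const_of_hasDerivAt_zero
    (f := fun r => Real.exp (a * r) • deriv c r) (s := s) (t := t) fun r hr => by
      have he : HasDerivAt (fun r => Real.exp (a * r)) (Real.exp (a * r) * a) r := by
        simpa using ((hasDerivAt_id r).const_mul a).exp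
      refine (he.smul (h3 r hr)).congr_deriv ?_
      simp [smul_smul]
  -- Now c'' = -ac', so both e^{ar}c' = w and ac + c' = p are constant, which gives c = a⁻¹p -
  -- a⁻¹e^{-ar}w.
  obtain ⟨p, hp⟩ := exists_const_of_hasDerivAt_zero
    (f := fun r => a • c r + deriv c r) (s := s) (t := t) fun r hr => by
      refine (((h1 r hr).const_smul a).add (h3 r hr)).congr_deriv ?_
      simp
  rw [collinear_iff_exists_forall_eq_smul_vadd]
  refine ⟨a⁻¹ • p, w, ?_⟩
  rintro _ ⟨r, hr, rfl⟩
  -- Positivity of a needs a point of the interval, which may be empty.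
  have ha0 : a ≠ 0 := by
    rw [← ha r hr]
    exact (funkStd_pos (hq r hr) (hc r hr).2.1).ne'
  have e1 : deriv c r = Real.exp (-(a * r)) • w := by
    rw [← hw r hr, smul_smul, ← Real.exp_add, neg_add_cancel, Real.exp_zero, one_smul]
  refine ⟨-(a⁻¹ * Real.exp (-(a * r))), ?_⟩
  rw [vadd_eq_add, ← hp r hr, e1, neg_smul, mul_smul, smul_add, inv_smul_smul₀ ha0]
  abel

theorem isLocallyProjectivelyFlat_of_eq_zero (hF : IsPerturbed 0 F) :
    IsLocallyProjectivelyFlat F (disk 0) := fun _ hp =>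
  ⟨OpenPartialHomeomorph.ofSet (disk 0) (isOpen_disk 0), hp, subset_rfl, contDiffOn_id,
    contDiffOn_id, fun _ _ _ hU hc => hc.collinear_image hF hU⟩

/-! ### Failure of projective flatness -/

lemma hasDerivAt_of_coord {c : ℝ → E 2} {c' : E 2} {t : ℝ}
    (h0 : HasDerivAt (fun s => c s 0) (c' 0) t) (h1 : HasDerivAt (fun s => c s 1) (c' 1) t) :
    HasDerivAt c c' t := by
  have h : HasDerivAt (fun s => WithLp.ofLp (c s)) (WithLp.ofLp c') t := by
    rw [hasDerivAt_pi]
    intro i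
    fin_cases i
    exacts [h0, h1]
  exact ((PiLp.hasFDerivAt_toLp (𝕜 := ℝ) 2 (WithLp.ofLp (c t))).comp_hasDerivAt t h)

/-- The unit speed geodesic of the perturbed metric that leaves the origin with velocity
`(1, 0)`. -/
def spiral (ε t : ℝ) : E 2 :=
  !₂[(1 - Real.exp (-t)) * Real.cos (ε * t), (1 - Real.exp (-t)) * Real.sin (ε * t)]

/-- The velocity of `spiral`. -/
def spiralVel (ε t : ℝ) : E 2 :=
  !₂[Real.exp (-t) * Real.cos (ε * t) - ε * ((1 - Real.exp (-t)) * Real.sin (ε * t)),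
    Real.exp (-t) * Real.sin (ε * t) + ε * ((1 - Real.exp (-t)) * Real.cos (ε * t))]

/-- The acceleration of `spiral`. -/
def spiralAcc (ε t : ℝ) : E 2 :=
  !₂[-Real.exp (-t) * Real.cos (ε * t) - 2 * ε * (Real.exp (-t) * Real.sin (ε * t))
      - ε ^ 2 * ((1 - Real.exp (-t)) * Real.cos (ε * t)),
    -Real.exp (-t) * Real.sin (ε * t) + 2 * ε * (Real.exp (-t) * Real.cos (ε * t))
      - ε ^ 2 * ((1 - Real.exp (-t)) * Real.sin (ε * t))]

section Spiral
variable (ε t : ℝ)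

lemma hasDerivAt_exp_neg : HasDerivAt (fun s => Real.exp (-s)) (-Real.exp (-t)) t := by
  simpa using (hasDerivAt_neg t).exp

lemma hasDerivAt_cos_mul : HasDerivAt (fun s => Real.cos (ε * s)) (-Real.sin (ε * t) * ε) t := by
  simpa using ((hasDerivAt_id t).const_mul ε).cos

lemma hasDerivAt_sin_mul : HasDerivAt (fun s => Real.sin (ε * s)) (Real.cos (ε * t) * ε) t := by
  simpa using ((hasDerivAt_id t).const_mul ε).sin

lemma hasDerivAt_spiral : HasDerivAt (spiral ε) (spiralVel ε t) t := by
  have he := hasDerivAt_exp_neg t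
  have hc := hasDerivAt_cos_mul ε t
  have hs := hasDerivAt_sin_mul ε t
  refine hasDerivAt_of_coord ?_ ?_
  · refine ((he.const_sub 1).fun_mul hc).congr_deriv ?_
    simp [spiralVel]; ring
  · refine ((he.const_sub 1).fun_mul hs).congr_deriv ?_
    simp [spiralVel]; ring

lemma hasDerivAt_spiralVel : HasDerivAt (spiralVel ε) (spiralAcc ε t) t := by
  have he := hasDerivAt_exp_neg t
  have hc := hasDerivAt_cos_mul ε t
  have hs := hasDerivAt_sin_mul ε t
  refine hasDerivAt_of_coord ?_ ?_
  · refine ((he.fun_mul hc).fun_sub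
      (((he.const_sub 1).fun_mul hs).const_mul ε)).congr_deriv ?_
    simp [spiralAcc]; ring
  · refine ((he.fun_mul hs).fun_add
      (((he.const_sub 1).fun_mul hc).const_mul ε)).congr_deriv ?_
    simp [spiralAcc]; ring

lemma spiralVel_ne_zero : spiralVel ε t ≠ 0 := by
  intro h
  have h0 := congrArg (fun v : E 2 => v 0) h
  have h1 := congrArg (fun v : E 2 => v 1) h
  simp [spiralVel] at h0 h1
  have := Real.exp_pos (-t)
  have : Real.exp (-t) * (Real.sin (ε * t) ^ 2 + Real.cos (ε * t) ^ 2) = 0 := by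
    linear_combination Real.cos (ε * t) * h0 + Real.sin (ε * t) * h1
  rw [Real.sin_sq_add_cos_sq] at this
  linarith

end Spiral

variable {ε : ℝ}

/-- In complex notation c = (1 - e^{-t})e^{iεt} and c' = e^{-t}e^{iεt} + iεc, so (c - iεc) + c' =
e^{iεt} lies on the unit circle. -/
lemma funkStd_spiral {t σ : ℝ} (hσ : σ ^ 2 = 1) (h : σ • spiral ε t ∈ disk ε) :
    funkStd (drift ε (σ • spiral ε t)) (σ • spiralVel ε t) = 1 := by
  rw [funkStd_eq_one_iff (mem_disk_iff.1 h), ← pow_eq_one_iff_of_nonneg (norm_nonneg _) two_ne_zero,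
    norm_sq_eq]
  have := Real.sin_sq_add_cos_sq (ε * t)
  simp [spiral, spiralVel]
  linear_combination hσ + σ ^ 2 * this

/-- With F = 1 along the curve the geodesic equation is linear in c, c', c''. The sign σ = ±1 gives
the spiral and its central reflection. -/
lemma isGeodesicOn_spiral (hF : IsPerturbed ε F) {σ : ℝ} (hσ : σ ^ 2 = 1) {I : Set ℝ}
    (hI : ∀ t ∈ I, σ • spiral ε t ∈ disk ε) :
    IsGeodesicOn F (fun t => σ • spiral ε t) I := by
  have hd : deriv (fun t => σ • spiral ε t) = fun t => σ • spiralVel ε t :=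
    funext fun t => ((hasDerivAt_spiral ε t).const_smul σ).deriv
  have hσ0 : σ ≠ 0 := by rintro rfl; simp at hσ
  intro t ht
  have h0 : σ • spiralVel ε t ≠ 0 := smul_ne_zero hσ0 (spiralVel_ne_zero ε t)
  refine ⟨((hasDerivAt_spiral ε t).const_smul σ).differentiableAt, ?_, ?_⟩
  · rw [hd]; exact h0
  · rw [hd]
    refine ((hasDerivAt_spiralVel ε t).const_smul σ).congr_deriv ?_
    ext i
    simp only [geodCoeff_eq hF (hI t ht) h0, spray, funkStd_spiral hσ (hI t ht)]
    fin_cases i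
    · simp [spiralAcc, spiralVel, spiral]
      ring
    · simp [spiralAcc, spiralVel, spiral]
      ring

/-- A curve inside a straight line has velocity and acceleration parallel. -/
lemma cross_eq_zero_of_collinear {γ γ' : ℝ → E 2} {γ'' : E 2} {δ : ℝ} (hδ : 0 < δ)
    (hc : Collinear ℝ (γ '' Ioo (-δ) δ)) (h1 : ∀ r ∈ Ioo (-δ) δ, HasDerivAt γ (γ' r) r)
    (h2 : HasDerivAt γ' γ'' 0) : γ' 0 0 * γ'' 1 - γ' 0 1 * γ'' 0 = 0 := by
  obtain ⟨p, w, hw⟩ := (collinear_iff_exists_forall_eq_smul_vadd (k := ℝ) _).1 hc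
  have hmem : Ioo (-δ) δ ∈ nhds (0 : ℝ) := Ioo_mem_nhds (by linarith) hδ
  have h0 : (0 : ℝ) ∈ Ioo (-δ) δ := mem_of_mem_nhds hmem
  have e1 : ∀ r ∈ Ioo (-δ) δ, w 0 * γ' r 1 - w 1 * γ' r 0 = 0 := by
    intro r hr
    have hd := ((hasDerivAt_coord (h1 r hr) 1).const_mul (w 0)).fun_sub
      ((hasDerivAt_coord (h1 r hr) 0).const_mul (w 1))
    have hcst : (fun r => w 0 * γ r 1 - w 1 * γ r 0) =ᶠ[nhds r]
        fun _ => w 0 * p 1 - w 1 * p 0 := by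
      filter_upwards [isOpen_Ioo.mem_nhds hr] with z hz
      obtain ⟨k, hk⟩ := hw _ ⟨z, hz, rfl⟩
      rw [hk]
      simp
      ring
    exact hd.unique ((hasDerivAt_const r _).congr_of_eventuallyEq hcst)
  have e2 : w 0 * γ'' 1 - w 1 * γ'' 0 = 0 := by
    have hd := ((hasDerivAt_coord h2 1).const_mul (w 0)).fun_sub
      ((hasDerivAt_coord h2 0).const_mul (w 1))
    refine hd.unique ((hasDerivAt_const 0 0).congr_of_eventuallyEq ?_)
    filter_upwards [hmem] with z hz using e1 z hz
  have e3 := e1 0 h0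
  by_cases hw0 : w 0 = 0
  · by_cases hw1 : w 1 = 0
    -- The direction of the line may be zero; the curve is then constant and its velocity vanishes.
    · have hcst : γ =ᶠ[nhds 0] fun _ => p := by
        filter_upwards [hmem] with z hz
        obtain ⟨k, hk⟩ := hw _ ⟨z, hz, rfl⟩
        rw [hk, show w = 0 by ext i; fin_cases i <;> simp [hw0, hw1]]
        simp
      rw [(h1 0 h0).unique ((hasDerivAt_const 0 p).congr_of_eventuallyEq hcst)]
      simp
    · refine mul_left_cancel₀ hw1 ?_
      linear_combination γ' 0 1 * e2 - γ'' 1 * e3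
  · refine mul_left_cancel₀ hw0 ?_
    linear_combination γ' 0 0 * e2 - γ'' 0 * e3

/-- The second order condition for the image of a curve to lie inside a straight line. -/
lemma cross_eq_zero_of_collinear_image {f : E 2 → E 2} {s : Set (E 2)} (hs : IsOpen s)
    (hf : ContDiffOn ℝ ∞ f s) {c c' : ℝ → E 2} {a x : E 2} {δ : ℝ} (hδ : 0 < δ) (hx : c 0 = x)
    (hc : ∀ r ∈ Ioo (-δ) δ, c r ∈ s) (h1 : ∀ r, HasDerivAt c (c' r) r) (h2 : HasDerivAt c' a 0)
    (hcol : Collinear ℝ ((fun r => f (c r)) '' Ioo (-δ) δ)) :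
    fderiv ℝ f x (c' 0) 0 *
        (fderiv ℝ (fderiv ℝ f) x (c' 0) (c' 0) + fderiv ℝ f x a) 1
      - fderiv ℝ f x (c' 0) 1 *
        (fderiv ℝ (fderiv ℝ f) x (c' 0) (c' 0) + fderiv ℝ f x a) 0 = 0 := by
  subst hx
  have hcd : ∀ r ∈ Ioo (-δ) δ, ContDiffAt ℝ ∞ f (c r) := fun r hr =>
    hf.contDiffAt (hs.mem_nhds (hc r hr))
  have hD2 : HasFDerivAt (fderiv ℝ f) (fderiv ℝ (fderiv ℝ f) (c 0)) (c 0) :=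
    (((hcd 0 ⟨by linarith, hδ⟩).fderiv_right (m := 1) (by decide)).differentiableAt
      one_ne_zero).hasFDerivAt
  have hγ : ∀ r ∈ Ioo (-δ) δ, HasDerivAt (fun r => f (c r)) (fderiv ℝ f (c r) (c' r)) r :=
    fun r hr => ((hcd r hr).differentiableAt (by simp)).hasFDerivAt.comp_hasDerivAt r (h1 r)
  exact cross_eq_zero_of_collinear hδ hcol hγ ((hD2.comp_hasDerivAt 0 (h1 0)).clm_apply h2)

/-- If e ≠ 0 the determinant of D vanishes; then each D(e₁)ᵢ e₀ - D(e₀)ᵢ e₁ lies in the kernel, so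
injectivity gives D e₀ = 0, a contradiction. -/
lemma eq_zero_of_cross_eq_zero {D : E 2 →L[ℝ] E 2} (hD : Function.Injective D) {e : ℝ}
    (h : D (basisVec 0) 0 * (e * D (basisVec 1) 1) -
      D (basisVec 0) 1 * (e * D (basisVec 1) 0) = 0) : e = 0 := by
  by_contra he
  have h' : D (basisVec 0) 0 * D (basisVec 1) 1 = D (basisVec 0) 1 * D (basisVec 1) 0 := by
    refine mul_left_cancel₀ he ?_
    linear_combination h
  have hz : ∀ i, D (basisVec 0) i = 0 := by
    intro i
    have : D (D (basisVec 1) i • basisVec 0 - D (basisVec 0) i • basisVec 1) = D 0 := by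
      rw [map_sub, map_smul, map_smul, map_zero]
      ext j
      fin_cases i <;> fin_cases j <;> simp <;> linarith
    have := congrArg (fun v : E 2 => v 1) (hD this)
    simpa using this
  have : D (basisVec 0) = D 0 := by
    rw [map_zero]; ext i; exact hz i
  simpa using congrArg (fun v : E 2 => v 0) (hD this)

/-- The two geodesics leave the origin in opposite directions and together look like (t, εt|t|) to
second order. Straight images under a smooth chart allow this only if ε = 0. -/
theorem eq_zero_of_isLocallyProjectivelyFlat (hF : IsPerturbed ε F)
    (h : IsLocallyProjectivelyFlat F (disk ε)) : ε = 0 := by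
  have h0 : (0 : E 2) ∈ disk ε :=
    Metric.mem_ball_self (div_pos one_pos (Real.sqrt_pos.2 (by positivity)))
  obtain ⟨φ, hφ0, hφU, hφ, hφs, hgeo⟩ := h 0 h0
  have hs0 : ∀ σ : ℝ, σ • spiral ε 0 = 0 := fun σ => by
    ext i; fin_cases i <;> simp [spiral]
  have hinj : Function.Injective (fderiv ℝ φ 0) := by
    have hD := ((hφ.contDiffAt (φ.open_source.mem_nhds hφ0)).differentiableAt
      (by simp)).hasFDerivAt
    have hS := ((hφs.contDiffAt (φ.open_target.mem_nhds (φ.map_source hφ0))).differentiableAt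
      (by simp)).hasFDerivAt
    have hid := (hS.comp (0 : E 2) hD).unique ((hasFDerivAt_id (0 : E 2)).congr_of_eventuallyEq
      (φ.eventually_left_inverse hφ0))
    exact Function.LeftInverse.injective (g := fderiv ℝ φ.symm (φ 0)) fun v => by
      simpa using congrArg (fun L => L v) hid
  have key : ∀ σ : ℝ, σ ^ 2 = 1 →
      fderiv ℝ φ 0 (σ • spiralVel ε 0) 0 *
        (fderiv ℝ (fderiv ℝ φ) 0 (σ • spiralVel ε 0) (σ • spiralVel ε 0)
          + fderiv ℝ φ 0 (σ • spiralAcc ε 0)) 1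
      - fderiv ℝ φ 0 (σ • spiralVel ε 0) 1 *
        (fderiv ℝ (fderiv ℝ φ) 0 (σ • spiralVel ε 0) (σ • spiralVel ε 0)
          + fderiv ℝ φ 0 (σ • spiralAcc ε 0)) 0 = 0 := by
    intro σ hσ
    have hc1 : ∀ t, HasDerivAt (fun t => σ • spiral ε t) (σ • spiralVel ε t) t :=
      fun t => (hasDerivAt_spiral ε t).const_smul σ
    have hmem : ∀ᶠ t in nhds (0 : ℝ), σ • spiral ε t ∈ φ.source :=
      (hc1 0).continuousAt.eventually_mem (φ.open_source.mem_nhds (by rwa [hs0]))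
    obtain ⟨δ, hδ, hball⟩ := Metric.eventually_nhds_iff_ball.1 hmem
    rw [Real.ball_eq_Ioo, zero_sub, zero_add] at hball
    exact cross_eq_zero_of_collinear_image φ.open_source hφ hδ (hs0 σ) hball hc1
      ((hasDerivAt_spiralVel ε 0).const_smul σ)
      (hgeo _ (-δ) δ hball (isGeodesicOn_spiral hF hσ fun t ht => hφU (hball t ht)))
  have k1 := key 1 (by norm_num)
  have k2 := key (-1) (by norm_num)
  have hv : spiralVel ε 0 = basisVec 0 := by
    ext i; fin_cases i <;> simp [spiralVel]
  have ha : spiralAcc ε 0 = -basisVec 0 + (2 * ε) • basisVec 1 := by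
    ext i; fin_cases i <;> simp [spiralAcc]
  rw [hv, ha] at k1 k2
  generalize fderiv ℝ (fderiv ℝ φ) 0 = Q at k1 k2
  generalize fderiv ℝ φ 0 = D at k1 k2 hinj
  refine eq_zero_of_cross_eq_zero hinj ?_
  simp only [one_smul, neg_smul, map_neg, map_add, map_smul, PiLp.add_apply, PiLp.neg_apply,
    PiLp.smul_apply, smul_eq_mul, _root_.neg_apply] at k1 k2
  -- The second-derivative term is odd in σ and cancels in the sum, whereas the acceleration term 2ε
  -- De₀ × De₁ is even.
  linear_combination (k1 + k2) / 4

end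

section

/-! ### The Gauss curvature of the Riemannian part -/

section Curve
variable {q : ℝ → E 2} {q' : E 2} {t : ℝ}

lemma hasDerivAt_gap (hq : HasDerivAt q q' t) :
    HasDerivAt (fun s => 1 - (q s 0 ^ 2 + q s 1 ^ 2))
      (-2 * (q t 0 * q' 0 + q t 1 * q' 1)) t := by
  refine ((((hasDerivAt_coord hq 0).fun_pow 2).fun_add
    ((hasDerivAt_coord hq 1).fun_pow 2)).const_sub 1).congr_deriv ?_
  simp
  ring

lemma hasDerivAt_div_gap {f : ℝ → ℝ} {f' : ℝ} (hq : HasDerivAt q q' t) (hq1 : ‖q t‖ < 1)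
    (hf : HasDerivAt f f' t) :
    HasDerivAt (fun s => f s / (1 - (q s 0 ^ 2 + q s 1 ^ 2)))
      (f' / (1 - (q t 0 ^ 2 + q t 1 ^ 2))
        + 2 * (q t 0 * q' 0 + q t 1 * q' 1) * f t / (1 - (q t 0 ^ 2 + q t 1 ^ 2)) ^ 2) t := by
  have hm := (gap_pos hq1).ne'
  refine (hf.fun_div (hasDerivAt_gap hq) hm).congr_deriv ?_
  field_simp
  ring

lemma hasDerivAt_div_gap_sq {f : ℝ → ℝ} {f' : ℝ} (hq : HasDerivAt q q' t) (hq1 : ‖q t‖ < 1)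
    (hf : HasDerivAt f f' t) :
    HasDerivAt (fun s => f s / (1 - (q s 0 ^ 2 + q s 1 ^ 2)) ^ 2)
      (f' / (1 - (q t 0 ^ 2 + q t 1 ^ 2)) ^ 2
        + 4 * (q t 0 * q' 0 + q t 1 * q' 1) * f t / (1 - (q t 0 ^ 2 + q t 1 ^ 2)) ^ 3) t := by
  have hm := (gap_pos hq1).ne'
  refine (hf.fun_div ((hasDerivAt_gap hq).fun_pow 2) (pow_ne_zero 2 hm)).congr_deriv ?_
  field_simp
  ring

end Curve

variable {ε : ℝ} {x : E 2}

lemma pd_randersA (hx : x ∈ disk ε) (i j k : Fin 2) :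
    pd i (fun z => randersA ε z j k) x =
      2 * (drift ε x 0 * drift ε (basisVec i) 0 + drift ε x 1 * drift ε (basisVec i) 1)
          * (if j = k then 1 else 0) / (1 - (drift ε x 0 ^ 2 + drift ε x 1 ^ 2)) ^ 2
        + (drift ε (basisVec i) j * drift ε x k + drift ε x j * drift ε (basisVec i) k)
          / (1 - (drift ε x 0 ^ 2 + drift ε x 1 ^ 2)) ^ 2
        + 4 * (drift ε x 0 * drift ε (basisVec i) 0 + drift ε x 1 * drift ε (basisVec i) 1)
          * (drift ε x j * drift ε x k) / (1 - (drift ε x 0 ^ 2 + drift ε x 1 ^ 2)) ^ 3 := by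
  have hq := hasDerivAt_drift_line ε x (basisVec i)
  have hq1 : ‖drift ε (x + (0 : ℝ) • basisVec i)‖ < 1 := by simpa using mem_disk_iff.1 hx
  rw [pd_eq (f := fun z => randersA ε z j k)
    ((hasDerivAt_div_gap hq hq1 (hasDerivAt_const 0 (if j = k then (1 : ℝ) else 0))).fun_add
      (hasDerivAt_div_gap_sq hq hq1 ((hasDerivAt_coord hq j).fun_mul (hasDerivAt_coord hq k))))]
  simp only [zero_smul, add_zero, zero_div, zero_add]
  ring

lemma randersA_inv (hx : x ∈ disk ε) :
    (randersA ε x)⁻¹ = Matrix.of fun i j => (1 - (drift ε x 0 ^ 2 + drift ε x 1 ^ 2)) *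
      ((if i = j then 1 else 0) - drift ε x i * drift ε x j) := by
  refine Matrix.inv_eq_right_inv ?_
  have hm := (gap_pos (mem_disk_iff.1 hx)).ne'
  ext i j
  simp only [Matrix.mul_apply, Fin.sum_univ_two, randersA, Matrix.of_apply, Matrix.one_apply]
  revert hm
  fin_cases i <;> fin_cases j <;> dsimp only [Fin.mk_one, Fin.zero_eta] <;>
    generalize drift ε x 0 = q0 <;> generalize drift ε x 1 = q1 <;> intro hm <;> simp <;>
    field_simp <;> ring

/-- The Christoffel symbols of the Riemannian part of the perturbed Funk metric, in terms of
`q = drift ε x`. -/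
def randersChristoffel (ε : ℝ) (q : E 2) (l i j : Fin 2) : ℝ :=
  ((q i + ε * rotation q i) * (if j = l then 1 else 0)
      + (q j + ε * rotation q j) * (if i = l then 1 else 0)
      - ε * (rotation q l * (if i = j then 1 else 0) + q j * rotation (basisVec i) l
        + q i * rotation (basisVec j) l)) / (1 - (q 0 ^ 2 + q 1 ^ 2))
    - 2 * ε * (rotation q l * (q i * q j)) / (1 - (q 0 ^ 2 + q 1 ^ 2)) ^ 2

lemma christoffel_randersA (hx : x ∈ disk ε) (l i j : Fin 2) :
    christoffel (randersA ε) l i j x = randersChristoffel ε (drift ε x) l i j := by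
  have hm := (gap_pos (mem_disk_iff.1 hx)).ne'
  simp only [christoffel, pd_randersA hx, randersA_inv hx, Fin.sum_univ_two, Matrix.of_apply,
    randersChristoffel]
  revert hm
  fin_cases l <;> fin_cases i <;> fin_cases j <;>
    dsimp only [Fin.mk_one, Fin.zero_eta] <;>
    simp only [rotation_zero_coord, rotation_one_coord] <;>
    generalize drift ε x 0 = q0 <;> generalize drift ε x 1 = q1 <;> intro hm <;> simp <;>
    field_simp <;> ring

/-- The derivative of `randersChristoffel` in the direction `v`. -/
def randersChristoffelDeriv (ε : ℝ) (q v : E 2) (l i j : Fin 2) : ℝ :=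
  ((v i + ε * rotation v i) * (if j = l then 1 else 0)
      + (v j + ε * rotation v j) * (if i = l then 1 else 0)
      - ε * (rotation v l * (if i = j then 1 else 0) + v j * rotation (basisVec i) l
        + v i * rotation (basisVec j) l)) / (1 - (q 0 ^ 2 + q 1 ^ 2))
    + 2 * (q 0 * v 0 + q 1 * v 1) *
      ((q i + ε * rotation q i) * (if j = l then 1 else 0)
      + (q j + ε * rotation q j) * (if i = l then 1 else 0)
      - ε * (rotation q l * (if i = j then 1 else 0) + q j * rotation (basisVec i) l
        + q i * rotation (basisVec j) l)) / (1 - (q 0 ^ 2 + q 1 ^ 2)) ^ 2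
    - (2 * ε * (rotation v l * (q i * q j) + rotation q l * (v i * q j + q i * v j))
        / (1 - (q 0 ^ 2 + q 1 ^ 2)) ^ 2
      + 4 * (q 0 * v 0 + q 1 * v 1) * (2 * ε * (rotation q l * (q i * q j)))
        / (1 - (q 0 ^ 2 + q 1 ^ 2)) ^ 3)

lemma pd_christoffel_randersA (hx : x ∈ disk ε) (k l i j : Fin 2) :
    pd k (christoffel (randersA ε) l i j) x =
      randersChristoffelDeriv ε (drift ε x) (drift ε (basisVec k)) l i j := by
  have hev : christoffel (randersA ε) l i j =ᶠ[nhds x]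
      fun z => randersChristoffel ε (drift ε z) l i j := by
    filter_upwards [(isOpen_disk ε).mem_nhds hx] with z hz using christoffel_randersA hz l i j
  rw [pd_congr hev]
  have hq := hasDerivAt_drift_line ε x (basisVec k)
  have hq1 : ‖drift ε (x + (0 : ℝ) • basisVec k)‖ < 1 := by simpa using mem_disk_iff.1 hx
  have hc := fun i => hasDerivAt_coord hq i
  have hr := fun i => hasDerivAt_rotation_coord hq i
  have hp := fun i => (hc i).fun_add ((hr i).const_mul ε)
  rw [pd_eq (f := fun z => randersChristoffel ε (drift ε z) l i j)
    ((hasDerivAt_div_gap hq hq1 ((((hp i).mul_const (if j = l then 1 else 0)).fun_add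
      ((hp j).mul_const (if i = l then 1 else 0))).fun_sub
      (((((hr l).mul_const (if i = j then 1 else 0)).fun_add
        ((hc j).mul_const (rotation (basisVec i) l))).fun_add
        ((hc i).mul_const (rotation (basisVec j) l))).const_mul ε))).fun_sub
      (hasDerivAt_div_gap_sq hq hq1 (((hr l).fun_mul ((hc i).fun_mul (hc j))).const_mul (2 * ε))))]
  simp only [zero_smul, add_zero, randersChristoffelDeriv]

/-- The metric α at x is the Klein metric at q applied to y itself, not to the image of y under
`drift`. It is not the pullback of the Klein metric, and its curvature depends on ε. -/
theorem gaussCurvature_randersA (hx : x ∈ disk ε) :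
    gaussCurvature (randersA ε) x =
      -(5 * (1 + ε ^ 2) - 4 + (ε ^ 2 - 1) * (drift ε x 0 ^ 2 + drift ε x 1 ^ 2))
        / (1 - (drift ε x 0 ^ 2 + drift ε x 1 ^ 2)) := by
  have hm := (gap_pos (mem_disk_iff.1 hx)).ne'
  rw [gaussCurvature, det_randersA hx]
  simp only [curvTensor, pd_christoffel_randersA hx, christoffel_randersA hx,
    Fin.sum_univ_two, randersA, Matrix.of_apply, randersChristoffel,
    randersChristoffelDeriv, drift_zero_coord ε (basisVec _), drift_one_coord ε (basisVec _),
    rotation_zero_coord, rotation_one_coord]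
  revert hm
  generalize drift ε x 0 = q0
  generalize drift ε x 1 = q1
  intro hm
  simp
  field_simp
  ring

/-- The Riemannian part is hyperbolic for the unperturbed metric. -/
theorem gaussCurvature_randersA_zero (hx : x ∈ disk 0) : gaussCurvature (randersA 0) x = -1 := by
  have hm := (gap_pos (mem_disk_iff.1 hx)).ne'
  rw [gaussCurvature_randersA hx, div_eq_iff hm]
  ring

theorem not_gaussCurvature_randersA_const (hε : ε ≠ 0) :
    ¬ ∃ c : ℝ, ∀ x ∈ disk ε, gaussCurvature (randersA ε) x = c := by
  rintro ⟨c, hc⟩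
  have hk : 0 < 1 + ε ^ 2 := by positivity
  have key : ∀ r : ℝ, (1 + ε ^ 2) * r ^ 2 < 1 →
      -(5 * (1 + ε ^ 2) - 4 + (ε ^ 2 - 1) * ((1 + ε ^ 2) * r ^ 2)) / (1 - (1 + ε ^ 2) * r ^ 2) = c := by
    intro r hr
    have hx : (!₂[r, 0] : E 2) ∈ disk ε := by
      rw [mem_disk_iff, ← sq_lt_one_iff₀ (norm_nonneg _), norm_drift_sq, norm_sq_eq]
      simpa using hr
    rw [← hc _ hx, gaussCurvature_randersA hx, ← norm_sq_eq, norm_drift_sq, norm_sq_eq]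
    simp
  -- The curvature is -(1 + 5ε²) at the centre and -(1 + 11ε²) where |q|² = 1/2.
  have k0 := key 0 (by simp)
  have hr : (1 + ε ^ 2) * Real.sqrt (1 / (2 * (1 + ε ^ 2))) ^ 2 = 1 / 2 := by
    rw [Real.sq_sqrt (by positivity)]
    field_simp
  have k1 := key _ (by rw [hr]; norm_num)
  rw [hr] at k1
  have : ε ^ 2 = 0 := by
    norm_num at k0 k1
    linarith
  exact hε (pow_eq_zero_iff two_ne_zero |>.1 this)

end

end Finsler

end

open Finsler
theorem theorem3 (ε : ℝ) :
    (∀ p ∈ disk ε, ∀ y : E 2, y ≠ 0 →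
      ∃! t : ℝ, 0 < t ∧ funk p (t⁻¹ • y - ε • rotation p) = 1) ∧
    ∀ F : E 2 → E 2 → ℝ, IsFunkPerturbation ε F →
      ∃ (a : E 2 → Matrix (Fin 2) (Fin 2) ℝ) (b : E 2 → Fin 2 → ℝ),
        IsRandersMetric F a b (disk ε) ∧
        HasConstFlagCurvature F (disk ε) (-1 / 4) ∧
        (∀ x ∈ disk ε, ∀ y, y ≠ 0 → sCurvature F x y = 3 / 2 * F x y) ∧
        (IsLocallyProjectivelyFlat F (disk ε) ↔ ε = 0) ∧
        (ε ≠ 0 → ¬ ∃ c : ℝ, ∀ x ∈ disk ε, gaussCurvature a x = c) ∧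
        (ε = 0 → ∀ x ∈ disk ε, gaussCurvature a x = -1) := by 
  refine ⟨fun p hp y hy => existsUnique_perturbation hp hy, fun F hF => ?_⟩
  have hP := hF.isPerturbed
  refine ⟨randersA ε, randersB ε, hP.isRandersMetric, hasConstFlagCurvature hP,
    fun x hx y hy => sCurvature_eq hP hx hy,
    ⟨eq_zero_of_isLocallyProjectivelyFlat hP, ?_⟩, not_gaussCurvature_randersA_const, ?_⟩
  · rintro rfl
    exact isLocallyProjectivelyFlat_of_eq_zero hP
  · rintro rfl x hx
    exact gaussCurvature_randersA_zero hx
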